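/- **Problem.** Let $p_s\ge 0$, $s=1,\dots,m$, $\sum_s p_s=1$, be scenario probabilities, $X\subset\mathbb R^{n_1}$ a set of first-stage decisions (possibly with integer coordinates), $f:\mathbb R^{n_1}\to\mathbb R$ a cost, and for each scenario $s$ let $q_s,T_s,W_s,h_s$ be second-stage data with feasible set $Y_s(x)=\{y\ge 0: T_sx+W_sy\ge h_s\}$. The outcome vector in $\mathbb R^d$ is $\hat g_s(x,y_s)=\bar g_sx+\tilde g_sy_s$. The benchmark $Z$ takes values $z_i\in\mathbb R^d$ with probabilities $\tilde p_i$, and $C\ne\emptyset$ is a polyhedron contained in the unit simplex of $\mathbb R^d$. For $\alpha\in[0,1)$ put $\mathrm{CVaR}_\alpha(V)=\min_\eta\{\eta+\frac1{1-\alpha}\mathbb E[V-\eta]_+\}$. Assume that $\inf\{q_s^\top y: y\in Y_s(x)\}>-\infty$ for all $x\in X$ and all $s$ (with $\inf\emptyset=+\infty$). The multivariate CVaR-constrained two-stage problem is $$\textup{(P)}\quad \min\ f(x)+\sum_s p_sq_s^\top y_s\quad\text{s.t. } x\in X,\ y_s\in Y_s(x)\ \forall s,\quad \mathrm{CVaR}_\alpha(c^\top\hat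 G(x,y))\le \mathrm{CVaR}_\alpha(c^\top Z)\ \ \forall c\in C ,$$ where $\hat G(x,y)$ equals $\hat g_s(x,y_s)$ in scenario $s$. **Algorithm.** Input: vectors $\tilde c_1,\dots,\tilde c_L\in C$ ($L\ge 0$), a tolerance $\epsilon\ge 0$, and for each $s$ a finite (possibly empty) list of affine bounds $\theta_s\ge a^\top x+a_0$ that are valid, i.e. $a^\top x+a_0\le q_s^\top y$ for all $x\in X$, $y\in Y_s(x)$. Set $u=\infty$, and let the sets of cuts be empty. For $\bar v=(x,\eta,w,\theta)$ and $(\gamma,\beta)\in\mathbb R^r\times\mathbb R^L$ write $\kappa_s(\gamma,\beta;\bar v)=\gamma^\top(h_s-T_sx)+\sum_{l\le L}\beta_l(\tilde c_l^\top\bar g_sx-\eta_l-w_{sl})$. Repeat: 1. Solve the relaxed master problem $(\mathrm{MP}^L)$: minimize $f(x)+\sum_sp_s\theta_s$ subject to $x\in X$, $\eta\in\mathbb R^L$, $w\ge 0$, $\eta_l+\frac1{1-\alpha}\sum_sp_sw_{sl}\le\mathrm{CVaR}_\alpha(\tilde c_l^\top Z)$ for $l\le L$, the initial bounds, the optimality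 cuts $\theta_s\ge\kappa_s(\gamma,\beta;v)$ and the feasibility cuts $0\ge\kappa_s(\gamma,\beta;v)$ generated so far. If it is infeasible, stop and report infeasibility. Otherwise let $\bar v=(\bar x,\bar\eta,\bar w,\bar\theta)$ be an optimal solution and $F$ the optimal value. 2. If $u<\infty$ and $|F-u|\le\epsilon|u|$, stop and return the solution recorded when $u$ was last set. 3. For each $s$ solve the subproblem $(\mathrm{PS}^L_s)$: minimize $q_s^\top y$ subject to $y\ge 0$, $W_sy\ge h_s-T_s\bar x$, $-\tilde c_l^\top\tilde g_sy\ge\tilde c_l^\top\bar g_s\bar x-\bar\eta_l-\bar w_{sl}$ ($l\le L$). Its dual is to maximize $\kappa_s(\gamma,\beta;\bar v)$ over $\gamma,\beta\ge 0$ with $W_s^\top\gamma-\sum_l\beta_l\tilde g_s^\top\tilde c_l\le q_s$. If it is infeasible, take an extreme ray $(\gamma,\beta)$ of the recession cone of the dual feasible region with $\kappa_s(\gamma,\beta;\bar v)>0$ and add the corresponding feasibility cut. If it is feasible, take an optimal solution $\bar y_s$ and an optimal extreme point $(\gamma,\beta)$ of the dual, and if $\bar\theta_s<q_s^\top\bar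 y_s$ add the corresponding optimality cut. 4. If all subproblems are feasible, let $c^*$ be any maximizer of $\mathrm{CVaR}_\alpha(c^\top\hat G(\bar x,\bar y))-\mathrm{CVaR}_\alpha(c^\top Z)$ over $c\in C$. If the maximum is $\le 0$, set $u=f(\bar x)+\sum_sp_sq_s^\top\bar y_s$ and record $(\bar x,\bar y)$; otherwise set $\tilde c_{L+1}=c^*$, $L\leftarrow L+1$ (old cuts get the coefficient $0$ for the new vector). **Proposition.** For arbitrary choices of the solutions, extreme points, rays and maximizers in these steps: 1. The algorithm performs only finitely many iterations: there is no infinite execution. 2. If it reports infeasibility, then (P) has no feasible solution. 3. If it returns $(\hat x,\hat y)$, then $(\hat x,\hat y)$ is feasible for (P), and $v-\epsilon|v|\le v'$, where $v$ is its objective value and $v'$ is the objective value of an arbitrary feasible solution of (P). In particular, for $\epsilon=0$ it is an optimal solution of (P). 4. In every iteration that is reached, if the relaxed master problem is infeasible or has an optimal solution, then all the steps can be carried out: the required optimal solutions, extreme points, rays and maximizers exist. So the algorithm ends with one of the two reports provided that every feasible relaxed master problem it meets has an optimal solution. 5. If $X$ is compact, $f$ is lower semicontinuous on $X$ and every $\theta_s$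 has at least one initial bound, then every feasible relaxed master problem that is met has an optimal solution. -/

import Mathlib

open scoped Matrix

/-- The conditional value-at-risk at level `α` of a finitely supported random variable with
realizations `v i` and probabilities `p i` (smaller values preferred):
`min_η { η + (1 - α)⁻¹ 𝔼[(V - η)₊] }`. -/
noncomputable def cvar {ι : Type*} [Fintype ι] (α : ℝ) (p v : ι → ℝ) : ℝ :=
  ⨅ η : ℝ, (η + (1 - α)⁻¹ * ∑ i, p i * max (v i - η) 0)

/-- The data of a two-stage program with a multivariate CVaR constraint: `n₁` first-stage and
`n₂` second-stage variables, `r` second-stage rows, `d` criteria, `m` scenarios, `t` benchmark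
realizations, `k` inequalities describing the scalarization polyhedron. -/
structure TwoStageCVaR (n₁ n₂ r d m t k : ℕ) where
  /-- first-stage feasible set (it may encode integrality of some of the coordinates) -/
  X : Set (Fin n₁ → ℝ)
  /-- first-stage cost -/
  f : (Fin n₁ → ℝ) → ℝ
  /-- scenario probabilities -/
  p : Fin m → ℝ
  p_nonneg : ∀ s, 0 ≤ p s
  p_sum : ∑ s, p s = 1
  /-- second-stage data of the scenarios -/
  q : Fin m → Fin n₂ → ℝ
  T : Fin m → Matrix (Fin r) (Fin n₁) ℝ
  W : Fin m → Matrix (Fin r) (Fin n₂) ℝ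
  h : Fin m → Fin r → ℝ
  /-- the outcome vector in scenario `s` is `gbar s *ᵥ x + gtil s *ᵥ y` -/
  gbar : Fin m → Matrix (Fin d) (Fin n₁) ℝ
  gtil : Fin m → Matrix (Fin d) (Fin n₂) ℝ
  /-- benchmark realizations and their probabilities -/
  z : Fin t → Fin d → ℝ
  pZ : Fin t → ℝ
  pZ_nonneg : ∀ i, 0 ≤ pZ i
  pZ_sum : ∑ i, pZ i = 1
  /-- confidence level -/
  α : ℝ
  α_nonneg : 0 ≤ α
  α_lt_one : α < 1
  /-- the scalarization set is the polyhedron `{c | A c ≤ b}`, a part of the unit simplex -/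
  A : Matrix (Fin k) (Fin d) ℝ
  b : Fin k → ℝ
  scal_nonempty : {c : Fin d → ℝ | A *ᵥ c ≤ b}.Nonempty
  scal_subset : {c : Fin d → ℝ | A *ᵥ c ≤ b} ⊆ stdSimplex ℝ (Fin d)
  /-- the second-stage values are greater than `-∞` -/
  recourse_bddBelow : ∀ x ∈ X, ∀ s,
    BddBelow ((fun y : Fin n₂ → ℝ => q s ⬝ᵥ y) '' {y | 0 ≤ y ∧ h s ≤ T s *ᵥ x + W s *ᵥ y})

/-- The multipliers `(γ, β)` of one scenario subproblem with `L` scalarization vectors. -/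
abbrev Multiplier (r L : ℕ) : Type := (Fin r → ℝ) × (Fin L → ℝ)

/-- A vector `(x, η, w, θ)` of variables of the relaxed master problem. -/
structure MasterPoint (n₁ m L : ℕ) where
  x : Fin n₁ → ℝ
  η : Fin L → ℝ
  w : Fin m → Fin L → ℝ
  θ : Fin m → ℝ

/-- The memory of the algorithm: the scalarization vectors generated so far, the optimality and
feasibility cuts (a scenario with its multiplier), and the solution that gave the current upper
bound `u` (`none` stands for `u = ∞`). -/
structure AlgState (n₁ n₂ r d m : ℕ) where
  L : ℕ
  c : Fin L → Fin d → ℝ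
  optCuts : Set (Fin m × Multiplier r L)
  feasCuts : Set (Fin m × Multiplier r L)
  incumbent : Option ((Fin n₁ → ℝ) × (Fin m → Fin n₂ → ℝ))

/-- The algorithm is running, or has stopped with one of its two reports. -/
inductive AlgConfig (n₁ n₂ r d m : ℕ) where
  | running (σ : AlgState n₁ n₂ r d m)
  | infeasible
  | optimal (x : Fin n₁ → ℝ) (y : Fin m → Fin n₂ → ℝ)

/-- A multiplier or a cut is kept when a scalarization vector is added; the new vector gets the
coefficient zero. -/
def Multiplier.extend {r L : ℕ} (π : Multiplier r L) : Multiplier r (L + 1) :=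
  (π.1, Fin.snoc (α := fun _ => ℝ) π.2 0)

namespace TwoStageCVaR

variable {n₁ n₂ r d m t k : ℕ} (D : TwoStageCVaR n₁ n₂ r d m t k)

/-- The scalarization set. -/
def C : Set (Fin d → ℝ) := {c | D.A *ᵥ c ≤ D.b}

/-- The second-stage feasible set of scenario `s`. -/
def Y (s : Fin m) (x : Fin n₁ → ℝ) : Set (Fin n₂ → ℝ) :=
  {y | 0 ≤ y ∧ D.h s ≤ D.T s *ᵥ x + D.W s *ᵥ y}

/-- The outcome vector of scenario `s`. -/
def outcome (x : Fin n₁ → ℝ) (y : Fin m → Fin n₂ → ℝ) (s : Fin m) : Fin d → ℝ :=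
  D.gbar s *ᵥ x + D.gtil s *ᵥ y s

/-- CVaR of the scalarized benchmark. -/
noncomputable def cvarZ (c : Fin d → ℝ) : ℝ := cvar D.α D.pZ (fun i => c ⬝ᵥ D.z i)

/-- CVaR of the scalarized decision-based outcome. -/
noncomputable def cvarG (x : Fin n₁ → ℝ) (y : Fin m → Fin n₂ → ℝ) (c : Fin d → ℝ) : ℝ :=
  cvar D.α D.p (fun s => c ⬝ᵥ D.outcome x y s)

/-! ### The problem to be solved -/

/-- Feasible first- and second-stage decisions of the multivariate CVaR-constrained problem. -/
def IsFeasible (x : Fin n₁ → ℝ) (y : Fin m → Fin n₂ → ℝ) : Prop :=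
  x ∈ D.X ∧ (∀ s, y s ∈ D.Y s x) ∧ ∀ c ∈ D.C, D.cvarG x y c ≤ D.cvarZ c

/-- First-stage cost plus expected second-stage cost. -/
noncomputable def objective (x : Fin n₁ → ℝ) (y : Fin m → Fin n₂ → ℝ) : ℝ :=
  D.f x + ∑ s, D.p s * (D.q s ⬝ᵥ y s)

def IsOptimal (x : Fin n₁ → ℝ) (y : Fin m → Fin n₂ → ℝ) : Prop :=
  D.IsFeasible x y ∧ ∀ x' y', D.IsFeasible x' y' → D.objective x y ≤ D.objective x' y'

/-- Optimal up to the relative tolerance `ε`. -/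
def IsOptimalWithin (ε : ℝ) (x : Fin n₁ → ℝ) (y : Fin m → Fin n₂ → ℝ) : Prop :=
  D.IsFeasible x y ∧ ∀ x' y', D.IsFeasible x' y' →
    D.objective x y - ε * |D.objective x y| ≤ D.objective x' y'

/-! ### Input of the algorithm -/

/-- The initial scalarization vectors, the tolerance, and the initial (possibly empty) lists of
valid affine lower bounds `θ_s ≥ a ⬝ x + a₀` on the second-stage values. -/
structure Input where
  L₀ : ℕ
  c₀ : Fin L₀ → Fin d → ℝ
  c₀_mem : ∀ l, c₀ l ∈ D.C
  ε : ℝ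
  ε_nonneg : 0 ≤ ε
  bounds : Fin m → List ((Fin n₁ → ℝ) × ℝ)
  bounds_valid : ∀ s, ∀ a ∈ bounds s, ∀ x ∈ D.X, ∀ y ∈ D.Y s x, a.1 ⬝ᵥ x + a.2 ≤ D.q s ⬝ᵥ y

/-! ### The relaxed master problem -/

/-- The expression `γᵀ (h_s - T_s x) + ∑_l β_l (c_lᵀ gbar_s x - η_l - w_sl)`: the right-hand side
of the cuts, and the objective of the dual of the scenario subproblem. -/
def cutValue {L : ℕ} (c : Fin L → Fin d → ℝ) (s : Fin m) (π : Multiplier r L)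
    (v : MasterPoint n₁ m L) : ℝ :=
  π.1 ⬝ᵥ (D.h s - D.T s *ᵥ v.x) +
    ∑ l, π.2 l * (c l ⬝ᵥ (D.gbar s *ᵥ v.x) - v.η l - v.w s l)

/-- Feasible points of the relaxed master problem. -/
def MasterFeasible (I : D.Input) (σ : AlgState n₁ n₂ r d m) (v : MasterPoint n₁ m σ.L) : Prop :=
  v.x ∈ D.X ∧
  (∀ s l, 0 ≤ v.w s l) ∧
  (∀ l, v.η l + (1 - D.α)⁻¹ * ∑ s, D.p s * v.w s l ≤ D.cvarZ (σ.c l)) ∧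
  (∀ s, ∀ a ∈ I.bounds s, a.1 ⬝ᵥ v.x + a.2 ≤ v.θ s) ∧
  (∀ a ∈ σ.optCuts, D.cutValue σ.c a.1 a.2 v ≤ v.θ a.1) ∧
  (∀ a ∈ σ.feasCuts, D.cutValue σ.c a.1 a.2 v ≤ 0)

noncomputable def masterObjective {L : ℕ} (v : MasterPoint n₁ m L) : ℝ :=
  D.f v.x + ∑ s, D.p s * v.θ s

/-- Optimal solutions of the relaxed master problem. -/
def MasterOptimal (I : D.Input) (σ : AlgState n₁ n₂ r d m) (v : MasterPoint n₁ m σ.L) : Prop :=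
  D.MasterFeasible I σ v ∧
    ∀ v', D.MasterFeasible I σ v' → D.masterObjective v ≤ D.masterObjective v'

/-! ### The scenario subproblems and their duals -/

/-- The feasible set of the subproblem of scenario `s` at the master solution `v`. -/
def subFeasible {L : ℕ} (c : Fin L → Fin d → ℝ) (v : MasterPoint n₁ m L) (s : Fin m) :
    Set (Fin n₂ → ℝ) :=
  {y | (∀ l, c l ⬝ᵥ (D.gbar s *ᵥ v.x) - v.η l - v.w s l ≤ -(c l ⬝ᵥ (D.gtil s *ᵥ y))) ∧
    D.h s - D.T s *ᵥ v.x ≤ D.W s *ᵥ y ∧ 0 ≤ y}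

/-- `y` is an optimal solution of the subproblem of scenario `s`. -/
def SubOptimal {L : ℕ} (c : Fin L → Fin d → ℝ) (v : MasterPoint n₁ m L) (s : Fin m)
    (y : Fin n₂ → ℝ) : Prop :=
  y ∈ D.subFeasible c v s ∧ ∀ y' ∈ D.subFeasible c v s, D.q s ⬝ᵥ y ≤ D.q s ⬝ᵥ y'

/-- The nonnegative multipliers with `W_sᵀ γ - ∑_l β_l gtil_sᵀ c_l ≤ a`. -/
def dualSet {L : ℕ} (c : Fin L → Fin d → ℝ) (s : Fin m) (a : Fin n₂ → ℝ) :
    Set (Multiplier r L) :=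
  {π | 0 ≤ π.1 ∧ 0 ≤ π.2 ∧
    (D.W s)ᵀ *ᵥ π.1 - ∑ l, π.2 l • ((D.gtil s)ᵀ *ᵥ c l) ≤ a}

/-- `π` is an extreme point of the dual feasible region that is optimal for the dual. -/
def DualOptimalVertex {L : ℕ} (c : Fin L → Fin d → ℝ) (v : MasterPoint n₁ m L) (s : Fin m)
    (π : Multiplier r L) : Prop :=
  π ∈ Set.extremePoints ℝ (D.dualSet c s (D.q s)) ∧
    ∀ π' ∈ D.dualSet c s (D.q s), D.cutValue c s π' v ≤ D.cutValue c s π v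

/-- `π` spans an extreme ray of the recession cone of the dual feasible region, and the dual
objective increases along it. -/
def DualUnboundedRay {L : ℕ} (c : Fin L → Fin d → ℝ) (v : MasterPoint n₁ m L) (s : Fin m)
    (π : Multiplier r L) : Prop :=
  π ≠ 0 ∧ π ∈ D.dualSet c s 0 ∧
    (∀ π₁ ∈ D.dualSet c s 0, ∀ π₂ ∈ D.dualSet c s 0, π₁ + π₂ = π → ∃ a : ℝ, 0 ≤ a ∧ π₁ = a • π) ∧
    0 < D.cutValue c s π v

/-- All the scenario subproblems at `v` are solved: `y s` and `π s` are optimal primal and dual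
solutions for the feasible ones, `π s` is a ray for the infeasible ones. -/
def SubproblemsSolved {L : ℕ} (c : Fin L → Fin d → ℝ) (v : MasterPoint n₁ m L)
    (y : Fin m → Fin n₂ → ℝ) (π : Fin m → Multiplier r L) : Prop :=
  ∀ s, ((D.subFeasible c v s).Nonempty → D.SubOptimal c v s (y s) ∧ D.DualOptimalVertex c v s (π s)) ∧
    (D.subFeasible c v s = ∅ → D.DualUnboundedRay c v s (π s))

/-- The optimality cuts after an iteration: the new ones come from the feasible subproblems
whose value exceeds the estimate `θ_s`. -/
def newOptCuts (σ : AlgState n₁ n₂ r d m) (v : MasterPoint n₁ m σ.L)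
    (y : Fin m → Fin n₂ → ℝ) (π : Fin m → Multiplier r σ.L) : Set (Fin m × Multiplier r σ.L) :=
  σ.optCuts ∪
    {a | (D.subFeasible σ.c v a.1).Nonempty ∧ v.θ a.1 < D.q a.1 ⬝ᵥ y a.1 ∧ a.2 = π a.1}

/-- The feasibility cuts after an iteration: the new ones come from the infeasible subproblems. -/
def newFeasCuts (σ : AlgState n₁ n₂ r d m) (v : MasterPoint n₁ m σ.L)
    (π : Fin m → Multiplier r σ.L) : Set (Fin m × Multiplier r σ.L) :=
  σ.feasCuts ∪ {a | D.subFeasible σ.c v a.1 = ∅ ∧ a.2 = π a.1}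

/-! ### The separation problem -/

/-- The violation `CVaR(cᵀ G) - CVaR(cᵀ Z)`. -/
noncomputable def violation (x : Fin n₁ → ℝ) (y : Fin m → Fin n₂ → ℝ) (c : Fin d → ℝ) : ℝ :=
  D.cvarG x y c - D.cvarZ c

/-- `c` is an optimal solution of the separation problem at `(x, y)`. -/
def SepOptimal (x : Fin n₁ → ℝ) (y : Fin m → Fin n₂ → ℝ) (c : Fin d → ℝ) : Prop :=
  c ∈ D.C ∧ ∀ c' ∈ D.C, D.violation x y c' ≤ D.violation x y c

/-! ### The algorithm -/

/-- The stopping test: the master value is within the relative tolerance of the upper bound,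
which is the objective value of the incumbent `(x, y)`. -/
def StopsWith (I : D.Input) (σ : AlgState n₁ n₂ r d m) (v : MasterPoint n₁ m σ.L)
    (x : Fin n₁ → ℝ) (y : Fin m → Fin n₂ → ℝ) : Prop :=
  σ.incumbent = some (x, y) ∧
    |D.masterObjective v - D.objective x y| ≤ I.ε * |D.objective x y|

/-- One pass through the loop. Wherever the algorithm solves a problem, any solution with the
stated property may be used. -/
inductive Step (I : D.Input) : AlgConfig n₁ n₂ r d m → AlgConfig n₁ n₂ r d m → Prop
  /-- the relaxed master problem is infeasible -/
  | infeasible (σ : AlgState n₁ n₂ r d m) (hinf : ∀ v, ¬ D.MasterFeasible I σ v) :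
      Step I (.running σ) .infeasible
  /-- the termination test succeeds -/
  | terminate (σ : AlgState n₁ n₂ r d m) (v : MasterPoint n₁ m σ.L) (hv : D.MasterOptimal I σ v)
      (x : Fin n₁ → ℝ) (y : Fin m → Fin n₂ → ℝ) (htest : D.StopsWith I σ v x y) :
      Step I (.running σ) (.optimal x y)
  /-- some subproblem is infeasible -/
  | cutOnly (σ : AlgState n₁ n₂ r d m) (v : MasterPoint n₁ m σ.L) (hv : D.MasterOptimal I σ v)
      (hns : ∀ x y, ¬ D.StopsWith I σ v x y)
      (y : Fin m → Fin n₂ → ℝ) (π : Fin m → Multiplier r σ.L)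
      (hsub : D.SubproblemsSolved σ.c v y π)
      (hinf : ∃ s, D.subFeasible σ.c v s = ∅) :
      Step I (.running σ) (.running
        { L := σ.L
          c := σ.c
          optCuts := D.newOptCuts σ v y π
          feasCuts := D.newFeasCuts σ v π
          incumbent := σ.incumbent })
  /-- all subproblems are feasible and there is no violated scalarization vector -/
  | improve (σ : AlgState n₁ n₂ r d m) (v : MasterPoint n₁ m σ.L) (hv : D.MasterOptimal I σ v)
      (hns : ∀ x y, ¬ D.StopsWith I σ v x y)
      (y : Fin m → Fin n₂ → ℝ) (π : Fin m → Multiplier r σ.L)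
      (hsub : D.SubproblemsSolved σ.c v y π)
      (hfeas : ∀ s, (D.subFeasible σ.c v s).Nonempty)
      (cstar : Fin d → ℝ) (hc : D.SepOptimal v.x y cstar) (hle : D.violation v.x y cstar ≤ 0) :
      Step I (.running σ) (.running
        { L := σ.L
          c := σ.c
          optCuts := D.newOptCuts σ v y π
          feasCuts := D.newFeasCuts σ v π
          incumbent := some (v.x, y) })
  /-- all subproblems are feasible and a violated scalarization vector is added -/
  | addColumn (σ : AlgState n₁ n₂ r d m) (v : MasterPoint n₁ m σ.L) (hv : D.MasterOptimal I σ v)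
      (hns : ∀ x y, ¬ D.StopsWith I σ v x y)
      (y : Fin m → Fin n₂ → ℝ) (π : Fin m → Multiplier r σ.L)
      (hsub : D.SubproblemsSolved σ.c v y π)
      (hfeas : ∀ s, (D.subFeasible σ.c v s).Nonempty)
      (cstar : Fin d → ℝ) (hc : D.SepOptimal v.x y cstar) (hpos : 0 < D.violation v.x y cstar) :
      Step I (.running σ) (.running
        { L := σ.L + 1
          c := Fin.snoc (α := fun _ => Fin d → ℝ) σ.c cstar
          optCuts := (fun a => (a.1, a.2.extend)) '' D.newOptCuts σ v y π
          feasCuts := (fun a => (a.1, a.2.extend)) '' D.newFeasCuts σ v π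
          incumbent := σ.incumbent })

/-- The initial configuration: no cuts beyond the given bounds, and `u = ∞`. -/
def start (I : D.Input) : AlgConfig n₁ n₂ r d m :=
  .running { L := I.L₀, c := I.c₀, optCuts := ∅, feasCuts := ∅, incumbent := none }

/-- The configurations that occur in some execution. -/
def Reachable (I : D.Input) (κ : AlgConfig n₁ n₂ r d m) : Prop :=
  Relation.ReflTransGen (D.Step I) (D.start I) κ

end TwoStageCVaR

/-! Correctness is relaxation. Every cut comes from a multiplier in `dualSet`, with right-hand side
`D.q s` for optimality cuts and `0` for feasibility cuts. By weak duality it holds at every feasible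
decision of (P), once η is taken as a value-at-risk of the scalarized outcome and w as the excess
over it. Hence the master value is a lower bound for (P), and infeasibility of the master problem
passes to (P) (`exists_masterFeasible`, `isOptimalWithin`).

Termination cannot rest on a finite list of candidates, since maximizers in the separation problem
are arbitrary and rays can be rescaled. What is finite is the set of sign patterns of slacks. If two
points of a polyhedron have the same tight inequalities, then one can step slightly beyond the
first, away from the second, without leaving the polyhedron. For dual vertices and extreme rays this
shows that a new cut never shares its pattern with an old one, as long as the scalarization vectors
stay the same. For the scalarization set, the pattern also records the order of the benchmark
realizations and the value-at-risk. On one pattern the benchmark CVaR is affine, so the violation is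
convex, and a maximizer has no larger violation than any vector with its pattern
(`violation_le_of_scalPattern_eq`). Generated vectors have violation at most zero, as η and w
certify, so a violated vector brings a new pattern. An iteration with neither a new vector nor a new
cut leaves the master problem unchanged and sets u to its optimal value, so the next test succeeds.
The lexicographic measure `progress` combines the three cases.

The steps can be carried out by Farkas' lemma (duality, attainment), Krein–Milman (vertices, rays)
and compactness of the scalarization set. The master problem is solved by projecting its polyhedral
part to a closed set in the first-stage decision and the expected second-stage estimate. -/

/-! ### Linear inequalities -/

section LinearInequalities

variable {V ι : Type*} [AddCommGroup V] [Module ℝ V]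

/-- Induction on the number of inequalities, without topology. If inequality `j` is needed, some
point violates the conclusion while satisfying all the others; projecting along it onto the kernel
of `a j` makes inequality `j` void there, so the induction hypothesis applies, and what the
projection drops is a nonnegative multiple of `a j`. -/
theorem farkas_finset (s : Finset ι) (g : V →ₗ[ℝ] ℝ) (a : ι → V →ₗ[ℝ] ℝ)
    (h : ∀ x, (∀ i ∈ s, a i x ≤ 0) → g x ≤ 0) :
    ∃ c : ι → ℝ, (∀ i, 0 ≤ c i) ∧ g = ∑ i ∈ s, c i • a i := by
  classical
  induction s using Finset.induction_on generalizing g a with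
  | empty =>
    refine ⟨0, fun _ => le_rfl, ?_⟩
    ext x
    have h₁ := h x (by simp)
    have h₂ := h (-x) (by simp)
    simp only [map_neg] at h₂
    simp only [Finset.sum_empty, LinearMap.zero_apply]
    linarith
  | insert j s hj ih =>
    by_cases hs : ∀ x, (∀ i ∈ s, a i x ≤ 0) → g x ≤ 0
    · obtain ⟨c, hc, hg⟩ := ih g a hs
      refine ⟨fun i => if i = j then 0 else c i, fun i => by dsimp only; split_ifs <;> simp [hc], ?_⟩
      rw [Finset.sum_insert hj, hg]
      simp only [if_true, zero_smul, zero_add]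
      exact Finset.sum_congr rfl fun i hi => by
        rw [if_neg (ne_of_mem_of_not_mem hi hj)]
    · push Not at hs
      obtain ⟨x₀, hx₀, hgx₀⟩ := hs
      have hpos : 0 < a j x₀ := by
        by_contra! hle
        exact absurd (h x₀ fun i hi => (Finset.mem_insert.1 hi).elim (fun e => e ▸ hle) (hx₀ i))
          (not_le.2 hgx₀)
      set x₁ : V := (a j x₀)⁻¹ • x₀ with hx₁
      have haj : a j x₁ = 1 := by simp [hx₁, hpos.ne']
      have hax : ∀ i ∈ s, a i x₁ ≤ 0 := fun i hi => by
        simpa [hx₁] using mul_nonpos_of_nonneg_of_nonpos (inv_nonneg.2 hpos.le) (hx₀ i hi)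
      have hgx : 0 < g x₁ := by simpa [hx₁] using mul_pos (inv_pos.2 hpos) hgx₀
      let P : V →ₗ[ℝ] V := LinearMap.id - (a j).smulRight x₁
      have hP : ∀ x, P x = x - a j x • x₁ := fun x => by simp [P]
      obtain ⟨c, hc, hg⟩ := ih (g ∘ₗ P) (fun i => a i ∘ₗ P) (fun x hx => h (P x) fun i hi => by
        rcases Finset.mem_insert.1 hi with rfl | hi
        · rw [hP]; simp [haj]
        · exact hx i hi)
      have hval : ∀ x, g x = ∑ i ∈ s, c i * a i x + (g x₁ - ∑ i ∈ s, c i * a i x₁) * a j x := by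
        intro x
        have := LinearMap.congr_fun hg x
        simp only [LinearMap.comp_apply, hP, map_sub, map_smul, smul_eq_mul, LinearMap.sum_apply,
          LinearMap.smul_apply, mul_sub, Finset.sum_sub_distrib] at this
        rw [sub_mul, Finset.sum_mul]
        have e : ∑ i ∈ s, c i * (a j x * a i x₁) = ∑ i ∈ s, c i * a i x₁ * a j x :=
          Finset.sum_congr rfl fun i _ => by ring
        rw [e] at this
        linarith
      have hnn : 0 ≤ g x₁ - ∑ i ∈ s, c i * a i x₁ := by
        have := Finset.sum_nonpos fun i hi =>
          mul_nonpos_of_nonneg_of_nonpos (hc i) (hax i hi)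
        linarith
      refine ⟨fun i => if i = j then g x₁ - ∑ i ∈ s, c i * a i x₁ else c i,
        fun i => by dsimp only; split_ifs <;> simp only [hc, hnn], ?_⟩
      ext x
      rw [Finset.sum_insert hj, hval x]
      simp only [if_true, LinearMap.add_apply, LinearMap.smul_apply, smul_eq_mul,
        LinearMap.sum_apply]
      rw [add_comm]
      congr 1
      exact Finset.sum_congr rfl fun i hi => by
        rw [if_neg (ne_of_mem_of_not_mem hi hj)]

variable [Fintype ι]

/-- If the functional `g` is bounded below by `τ` on the nonempty polyhedron `{x | a x ≤ b}`,
then some nonnegative multipliers prove it. -/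
theorem exists_multipliers_of_forall_le (a : ι → V →ₗ[ℝ] ℝ) (b : ι → ℝ) (g : V →ₗ[ℝ] ℝ) (τ : ℝ)
    (hne : ∃ x, ∀ i, a i x ≤ b i) (h : ∀ x, (∀ i, a i x ≤ b i) → τ ≤ g x) :
    ∃ c : ι → ℝ, (∀ i, 0 ≤ c i) ∧ (∀ x, ∑ i, c i * a i x = -g x) ∧ τ ≤ -∑ i, c i * b i := by
  obtain ⟨x₀, hx₀⟩ := hne
  -- Homogenization: an extra coordinate `t ≥ 0` turns the affine system into the cone `a i x ≤ b i
  -- * t`, and the claim into `τ * t ≤ g x`.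
  let A : Option ι → (V × ℝ) →ₗ[ℝ] ℝ := fun o => o.elim (-LinearMap.snd ℝ V ℝ)
    (fun i => a i ∘ₗ LinearMap.fst ℝ V ℝ - b i • LinearMap.snd ℝ V ℝ)
  let G : (V × ℝ) →ₗ[ℝ] ℝ := τ • LinearMap.snd ℝ V ℝ - g ∘ₗ LinearMap.fst ℝ V ℝ
  obtain ⟨c, hc, hG⟩ := farkas_finset Finset.univ G A (by
    rintro ⟨x, t⟩ hx
    have ht : 0 ≤ t := by simpa [A] using hx none (Finset.mem_univ _)
    have hi : ∀ i, a i x ≤ b i * t := fun i => by simpa [A] using hx (some i) (Finset.mem_univ _)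
    suffices τ * t ≤ g x by simpa [G] using this
    rcases ht.eq_or_lt with rfl | ht
    -- For `t = 0` the vector `x` is a recession direction. The step length is chosen so that `g`
    -- falls from `g x₀` by `|g x₀ - τ| + 1`, hence below `τ`.
    · by_contra! hlt
      rw [mul_zero] at hlt
      have hs : 0 ≤ (|g x₀ - τ| + 1) / (-g x) := div_nonneg (by positivity) (by linarith)
      have := h (x₀ + ((|g x₀ - τ| + 1) / (-g x)) • x) fun i => by
        have := mul_nonpos_of_nonneg_of_nonpos hs ((hi i).trans_eq (mul_zero _))
        simp only [map_add, map_smul, smul_eq_mul]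
        linarith [hx₀ i]
      simp only [map_add, map_smul, smul_eq_mul] at this
      have e : (|g x₀ - τ| + 1) / (-g x) * g x = -(|g x₀ - τ| + 1) := by
        field_simp [hlt.ne]
      rw [e] at this
      linarith [le_abs_self (g x₀ - τ)]
    · have := h (t⁻¹ • x) fun i => by
        have := mul_le_mul_of_nonneg_left (hi i) (inv_nonneg.2 ht.le)
        rw [map_smul, smul_eq_mul]
        calc _ ≤ _ := this
          _ = b i := by field_simp
      rw [map_smul, smul_eq_mul] at this
      have := mul_le_mul_of_nonneg_left this ht.le
      rw [mul_inv_cancel_left₀ ht.ne'] at this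
      linarith)
  refine ⟨fun i => c (some i), fun i => hc _, fun x => ?_, ?_⟩
  · have := LinearMap.congr_fun hG (x, 0)
    simp only [G, A, Fintype.sum_option] at this
    simpa using this.symm
  · have := LinearMap.congr_fun hG (0, 1)
    simp only [G, A, Fintype.sum_option] at this
    simp at this
    linarith [hc none]

/-- Gale's theorem of the alternative. -/
theorem exists_multipliers_of_infeasible (a : ι → V →ₗ[ℝ] ℝ) (b : ι → ℝ)
    (h : ¬ ∃ x, ∀ i, a i x ≤ b i) :
    ∃ c : ι → ℝ, (∀ i, 0 ≤ c i) ∧ (∀ x, ∑ i, c i * a i x = 0) ∧ ∑ i, c i * b i < 0 := by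
  -- Homogenized, infeasibility says that `a i x ≤ b i * t` for all `i` forces `t ≤ 0`.
  obtain ⟨c, hc, hG⟩ := farkas_finset Finset.univ (LinearMap.snd ℝ V ℝ)
    (fun i => a i ∘ₗ LinearMap.fst ℝ V ℝ - b i • LinearMap.snd ℝ V ℝ) (by
      rintro ⟨x, t⟩ hx
      have hi : ∀ i, a i x ≤ b i * t := fun i => by simpa using hx i (Finset.mem_univ _)
      by_contra! ht
      simp only [LinearMap.snd_apply] at ht
      refine h ⟨t⁻¹ • x, fun i => ?_⟩
      rw [map_smul, smul_eq_mul]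
      calc _ ≤ _ := mul_le_mul_of_nonneg_left (hi i) (inv_nonneg.2 ht.le)
        _ = b i := by field_simp)
  refine ⟨c, hc, fun x => ?_, ?_⟩
  · simpa using (LinearMap.congr_fun hG (x, 0)).symm
  · have := LinearMap.congr_fun hG (0, 1)
    simp at this
    linarith

/-- The right-hand sides of the solvable systems of linear inequalities form a closed set. -/
theorem isClosed_setOf_exists_forall_le (a : ι → V →ₗ[ℝ] ℝ) :
    IsClosed {b : ι → ℝ | ∃ x, ∀ i, a i x ≤ b i} := by
  -- By the theorem of the alternative, the set is an intersection of closed half-spaces.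
  have : {b : ι → ℝ | ∃ x, ∀ i, a i x ≤ b i} =
      ⋂ c ∈ {c : ι → ℝ | (∀ i, 0 ≤ c i) ∧ ∀ x, ∑ i, c i * a i x = 0},
        {b | 0 ≤ ∑ i, c i * b i} := by
    ext b
    simp only [Set.mem_ofPred_eq, Set.mem_iInter]
    constructor
    · rintro ⟨x, hx⟩ c ⟨hc, hc₀⟩
      rw [← hc₀ x]
      exact Finset.sum_le_sum fun i _ => mul_le_mul_of_nonneg_left (hx i) (hc i)
    · intro hb
      by_contra h
      obtain ⟨c, hc, hc₀, hlt⟩ := exists_multipliers_of_infeasible a b h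
      exact absurd (hb c ⟨hc, hc₀⟩) (not_le.2 hlt)
  rw [this]
  exact isClosed_biInter fun c _ => isClosed_le continuous_const (by fun_prop)

/-- The projection of a polyhedron is closed; here the right-hand sides depend continuously on
a parameter. -/
theorem Set.Finite.isClosed_setOf_exists_forall_le {E : Type*} [TopologicalSpace E]
    {S : Set ((V →ₗ[ℝ] ℝ) × C(E, ℝ))} (hS : S.Finite) :
    IsClosed {e : E | ∃ x, ∀ a ∈ S, a.1 x ≤ a.2 e} := by
  have := hS.fintype
  have hcl := (_root_.isClosed_setOf_exists_forall_le (fun a : S => a.1.1)).preimage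
    (f := fun e => fun a : S => a.1.2 e) (by fun_prop)
  convert hcl using 1
  ext e
  simp

/-- A linear functional that is bounded below on a nonempty polyhedron attains its minimum. -/
theorem exists_forall_le_of_bddBelow (a : ι → V →ₗ[ℝ] ℝ) (b : ι → ℝ) (g : V →ₗ[ℝ] ℝ)
    (hne : ∃ x, ∀ i, a i x ≤ b i) (τ : ℝ) (h : ∀ x, (∀ i, a i x ≤ b i) → τ ≤ g x) :
    ∃ x, (∀ i, a i x ≤ b i) ∧ ∀ x', (∀ i, a i x' ≤ b i) → g x ≤ g x' := by
  -- The levels `e` reached by some feasible point form a closed set, so their infimum is itself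
  -- reached.
  have hcl : IsClosed {e : ℝ | ∃ x, ∀ o : Option ι,
      (o.elim g a) x ≤ o.elim e b} := by
    refine (isClosed_setOf_exists_forall_le (fun o : Option ι => o.elim g a)).preimage
      (f := fun (e : ℝ) (o : Option ι) => o.elim e b) ?_
    refine continuous_pi fun o => ?_
    cases o <;> simp <;> fun_prop
  obtain ⟨x₀, hx₀⟩ := hne
  have hmem := hcl.csInf_mem ⟨g x₀, x₀, fun o => by cases o <;> simp [hx₀]⟩
    ⟨τ, fun e ⟨x, hx⟩ => (h x fun i => hx (some i)).trans (hx none)⟩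
  obtain ⟨x, hx⟩ := hmem
  refine ⟨x, fun i => hx (some i), fun x' hx' => (hx none).trans (csInf_le
    ⟨τ, fun e ⟨x, hx⟩ => (h x fun i => hx (some i)).trans (hx none)⟩
    ⟨x', fun o => by cases o <;> simp [hx']⟩)⟩

end LinearInequalities

/-! ### Extreme points -/

section ExtremePoints

variable {E : Type*} [AddCommGroup E] [Module ℝ E] {A : Set E}

/-- An extreme point does not lie strictly between two other points of the set. -/
theorem eq_of_mem_extremePoints_of_extrapolate {x y : E} (hx : x ∈ Set.extremePoints ℝ A)
    (hy : y ∈ A) {e : ℝ} (he : 0 < e) (hxy : x + e • (x - y) ∈ A) : y = x := by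
  refine (mem_extremePoints.1 hx).2 (x + e • (x - y)) hxy y hy ?_ |>.2
  refine ⟨1 / (1 + e), e / (1 + e), by positivity, by positivity, by field_simp, ?_⟩
  have h₁ : (1 + e) ≠ 0 := by positivity
  have : (1 + e) • ((1 / (1 + e)) • (x + e • (x - y)) + (e / (1 + e)) • y) = (1 + e) • x := by
    rw [smul_add, smul_smul, smul_smul, mul_div_cancel₀ _ h₁, mul_div_cancel₀ _ h₁]
    module
  exact smul_right_injective E h₁ this

variable [TopologicalSpace E] [T2Space E] [IsTopologicalAddGroup E] [ContinuousSMul ℝ E]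
  [LocallyConvexSpace ℝ E]

/-- If the closed set `A` has compact sublevel sets for some linear functional, then the maximum
of a linear functional over `A`, if attained, is attained at an extreme point. -/
theorem exists_mem_extremePoints_isMaxOn (hA : IsClosed A) (g σ : E →L[ℝ] ℝ)
    (hσ : ∀ a : ℝ, IsCompact {x ∈ A | σ x ≤ a}) {x₀ : E} (hx₀ : x₀ ∈ A) (hmax : IsMaxOn g A x₀) :
    ∃ x ∈ Set.extremePoints ℝ A, IsMaxOn g A x := by
  -- The face `B` of maximizers may be unbounded. Minimizing `σ` over it gives a compact exposed
  -- face `B'`, and extreme points of a face of a face are extreme in `A`.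
  set B : Set E := {x ∈ A | ∀ y ∈ A, g y ≤ g x} with hB
  set B' : Set E := {x ∈ B | ∀ y ∈ B, (-σ) y ≤ (-σ) x} with hB'
  have hAB : IsExposed ℝ A B := fun _ => ⟨g, rfl⟩
  have hBB' : IsExposed ℝ B B' := fun _ => ⟨-σ, rfl⟩
  have hxB : x₀ ∈ B := ⟨hx₀, fun y hy => hmax hy⟩
  have hBc : IsClosed B := hAB.isClosed hA
  have hK : IsCompact {x ∈ B | σ x ≤ σ x₀} := by
    refine (hσ (σ x₀)).of_isClosed_subset ?_ fun x hx => ⟨hx.1.1, hx.2⟩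
    exact hBc.inter (isClosed_le σ.continuous continuous_const)
  obtain ⟨x₁, hx₁, hmin⟩ := hK.exists_isMinOn ⟨x₀, hxB, le_rfl⟩ σ.continuous.continuousOn
  have hx₁B' : x₁ ∈ B' := ⟨hx₁.1, fun y hy => by
    simp only [neg_apply, neg_le_neg_iff]
    rcases le_total (σ y) (σ x₀) with h | h
    · exact hmin ⟨hy, h⟩
    · exact hx₁.2.trans h⟩
  have hB'K : IsCompact B' := by
    refine hK.of_isClosed_subset (hBB'.isClosed hBc) fun x hx => ⟨hx.1, ?_⟩
    simpa using hx.2 x₀ hxB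
  obtain ⟨x, hx⟩ := hB'K.extremePoints_nonempty ⟨x₁, hx₁B'⟩
  refine ⟨x, (hAB.isExtreme.trans hBB'.isExtreme).extremePoints_subset_extremePoints hx, ?_⟩
  exact fun y hy => (extremePoints_subset hx).1.2 y hy

end ExtremePoints

/-! ### Sign patterns -/

/-- A nonzero `a` keeps its sign by continuity; if `a = 0`, then `b = 0` too and nothing moves.
Applied to slacks, this is the step beyond a point on which all of the termination argument rests.
-/
theorem sign_extrapolate {a b : ℝ} (h : SignType.sign a = SignType.sign b) :
    ∀ᶠ e in nhdsWithin (0 : ℝ) (Set.Ioi 0), SignType.sign (a + e * (a - b)) = SignType.sign a := by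
  have ht : Filter.Tendsto (fun e : ℝ => a + e * (a - b)) (nhdsWithin 0 (Set.Ioi 0)) (nhds a) := by
    have : Continuous fun e : ℝ => a + e * (a - b) := by fun_prop
    simpa using (this.tendsto 0).mono_left nhdsWithin_le_nhds
  rcases lt_trichotomy a 0 with ha | rfl | ha
  · filter_upwards [ht.eventually (gt_mem_nhds ha)] with e he
    rw [sign_neg he, sign_neg ha]
  · rw [sign_zero, eq_comm, sign_eq_zero_iff] at h
    simp [h]
  · filter_upwards [ht.eventually (lt_mem_nhds ha)] with e he
    rw [sign_pos he, sign_pos ha]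

theorem nonneg_of_sign_eq {a b : ℝ} (h : SignType.sign a = SignType.sign b) (hb : 0 ≤ b) :
    0 ≤ a := by
  rwa [← sign_nonneg_iff, h, sign_nonneg_iff]

/-- The positive part is linear on each side of zero, and all three points lie on the same side. -/
theorem max_zero_extrapolate {a b e : ℝ} (h : SignType.sign a = SignType.sign b)
    (he : SignType.sign (a + e * (a - b)) = SignType.sign a) :
    max (a + e * (a - b)) 0 = max a 0 + e * (max a 0 - max b 0) := by
  rcases le_total 0 a with ha | ha
  · rw [max_eq_left ha, max_eq_left (nonneg_of_sign_eq h.symm ha),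
      max_eq_left (nonneg_of_sign_eq he ha)]
  · have hb : b ≤ 0 := by rwa [← sign_nonpos_iff, ← h, sign_nonpos_iff]
    have hc : a + e * (a - b) ≤ 0 := by rwa [← sign_nonpos_iff, he, sign_nonpos_iff]
    rw [max_eq_right ha, max_eq_right hb, max_eq_right hc]
    ring

/-! ### Conditional value-at-risk -/

section CVaR

variable {ι : Type*} [Fintype ι] {α : ℝ} {p v : ι → ℝ}

/-- The function of `η` whose minimum is the conditional value-at-risk. -/
noncomputable def cvarFun (α : ℝ) (p v : ι → ℝ) (η : ℝ) : ℝ :=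
  η + (1 - α)⁻¹ * ∑ i, p i * max (v i - η) 0

/-- The function is affine between consecutive realizations, with slope `1 - κ * P(V > η)`.
According to the sign of the slope, one moves right to the next realization or left to the previous
one. If none lies in the desired direction, the slope is `1 - κ ≤ 0` or `1`, which points the other
way. -/
theorem exists_cvarFun_le (hα : 0 ≤ α) (hα' : α < 1) (hp₁ : ∑ i, p i = 1)
    (v : ι → ℝ) (η : ℝ) : ∃ i, cvarFun α p v (v i) ≤ cvarFun α p v η := by
  classical
  set κ : ℝ := (1 - α)⁻¹ with hκ
  have hκ₁ : 1 ≤ κ := (one_le_inv₀ (by linarith)).2 (by linarith)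
  set H : Finset ι := Finset.univ.filter fun i => η < v i with hH
  set Lo : Finset ι := Finset.univ.filter fun i => v i ≤ η with hLo
  -- The premise on `b` says that no realization is crossed on the way from `η`.
  have key : ∀ b : ℝ, (∀ i, max (v i - b) 0 = max (v i - η) 0 - if η < v i then b - η else 0) →
      cvarFun α p v b = cvarFun α p v η + (b - η) * (1 - κ * ∑ i ∈ H, p i) := by
    intro b hb
    have : ∑ i, p i * max (v i - b) 0 = ∑ i, p i * max (v i - η) 0 - (b - η) * ∑ i ∈ H, p i := by
      rw [hH, Finset.sum_filter, Finset.mul_sum, ← Finset.sum_sub_distrib]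
      refine Finset.sum_congr rfl fun i _ => ?_
      rw [hb i]
      split_ifs <;> ring
    simp only [cvarFun, this, ← hκ]
    ring
  have right : H.Nonempty → 1 - κ * ∑ i ∈ H, p i ≤ 0 →
      ∃ i, cvarFun α p v (v i) ≤ cvarFun α p v η := by
    intro hne hs
    obtain ⟨i, hi, hmin⟩ := H.exists_min_image v hne
    have hηi : η < v i := (Finset.mem_filter.1 hi).2
    refine ⟨i, ?_⟩
    rw [key (v i) fun j => ?_]
    · linarith [mul_nonneg_of_nonpos_of_nonpos (sub_nonpos.2 hηi.le) hs,
        mul_nonpos_of_nonneg_of_nonpos (sub_nonneg.2 hηi.le) hs]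
    · split_ifs with h
      · have := hmin j (Finset.mem_filter.2 ⟨Finset.mem_univ _, h⟩)
        rw [max_eq_left (by linarith), max_eq_left (by linarith)]
        ring
      · rw [max_eq_right (by linarith), max_eq_right (by linarith), sub_zero]
  have left : Lo.Nonempty → 0 ≤ 1 - κ * ∑ i ∈ H, p i →
      ∃ i, cvarFun α p v (v i) ≤ cvarFun α p v η := by
    intro hne hs
    obtain ⟨i, hi, hmax⟩ := Lo.exists_max_image v hne
    have hηi : v i ≤ η := (Finset.mem_filter.1 hi).2
    refine ⟨i, ?_⟩
    rw [key (v i) fun j => ?_]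
    · linarith [mul_nonpos_of_nonpos_of_nonneg (sub_nonpos.2 hηi) hs]
    · split_ifs with h
      · rw [max_eq_left (by linarith), max_eq_left (by linarith)]
        ring
      · have := hmax j (Finset.mem_filter.2 ⟨Finset.mem_univ _, not_lt.1 h⟩)
        rw [max_eq_right (by linarith), max_eq_right (by linarith), sub_zero]
  rcases H.eq_empty_or_nonempty with hHe | hHn
  · have hne : Lo.Nonempty := by
      by_contra hLe
      rw [Finset.not_nonempty_iff_eq_empty] at hLe
      have : (Finset.univ : Finset ι) = ∅ := Finset.eq_empty_of_forall_notMem fun i _ => by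
        rcases le_or_gt (v i) η with h | h
        · exact Finset.notMem_empty i (hLe ▸ (Finset.mem_filter.2 ⟨Finset.mem_univ i, h⟩ : i ∈ Lo))
        · exact Finset.notMem_empty i (hHe ▸ (Finset.mem_filter.2 ⟨Finset.mem_univ i, h⟩ : i ∈ H))
      rw [this] at hp₁
      simp at hp₁
    exact left hne (by simp [hHe])
  · rcases Lo.eq_empty_or_nonempty with hLe | hLn
    · refine right hHn ?_
      have : H = Finset.univ := Finset.eq_univ_iff_forall.2 fun i =>
        Finset.mem_filter.2 ⟨Finset.mem_univ i, by
          by_contra h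
          exact Finset.notMem_empty i
            (hLe ▸ (Finset.mem_filter.2 ⟨Finset.mem_univ i, not_lt.1 h⟩ : i ∈ Lo))⟩
      rw [this, hp₁]
      linarith
    · rcases le_total (1 - κ * ∑ i ∈ H, p i) 0 with h | h
      · exact right hHn h
      · exact left hLn h

/-- The minimum in the definition of the conditional value-at-risk is attained at a realization
of the random variable. -/
theorem exists_cvarFun_eq_cvar (hα : 0 ≤ α) (hα' : α < 1) (hp₁ : ∑ i, p i = 1) (v : ι → ℝ) :
    ∃ i, cvarFun α p v (v i) = cvar α p v ∧ ∀ η, cvar α p v ≤ cvarFun α p v η := by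
  obtain ⟨i₀, -⟩ := exists_cvarFun_le hα hα' hp₁ v 0
  obtain ⟨i, -, hi⟩ := Finset.univ.exists_min_image (fun i => cvarFun α p v (v i))
    ⟨i₀, Finset.mem_univ _⟩
  have hmin : ∀ η, cvarFun α p v (v i) ≤ cvarFun α p v η := fun η => by
    obtain ⟨j, hj⟩ := exists_cvarFun_le hα hα' hp₁ v η
    exact (hi j (Finset.mem_univ _)).trans hj
  have heq : cvarFun α p v (v i) = cvar α p v :=
    le_antisymm (le_ciInf hmin) (ciInf_le ⟨_, Set.forall_mem_range.2 hmin⟩ (v i))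
  exact ⟨i, heq, heq ▸ hmin⟩

theorem cvar_le_cvarFun (hα : 0 ≤ α) (hα' : α < 1) (hp₁ : ∑ i, p i = 1) (v : ι → ℝ) (η : ℝ) : cvar α p v ≤ cvarFun α p v η :=
  (exists_cvarFun_eq_cvar hα hα' hp₁ v).choose_spec.2 η

/-- The sum of two minimizers is a candidate for the sum, and the positive part is subadditive. -/
theorem cvar_add_le (hα : 0 ≤ α) (hα' : α < 1) (hp : ∀ i, 0 ≤ p i) (hp₁ : ∑ i, p i = 1)
    (u v : ι → ℝ) : cvar α p (u + v) ≤ cvar α p u + cvar α p v := by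
  obtain ⟨i, hi, -⟩ := exists_cvarFun_eq_cvar hα hα' hp₁ u
  obtain ⟨j, hj, -⟩ := exists_cvarFun_eq_cvar hα hα' hp₁ v
  refine (cvar_le_cvarFun hα hα' hp₁ (u + v) (u i + v j)).trans ?_
  rw [← hi, ← hj]
  have hκ : 0 ≤ (1 - α)⁻¹ := inv_nonneg.2 (by linarith)
  have : ∑ l, p l * max ((u + v) l - (u i + v j)) 0 ≤
      ∑ l, p l * max (u l - u i) 0 + ∑ l, p l * max (v l - v j) 0 := by
    rw [← Finset.sum_add_distrib]
    refine Finset.sum_le_sum fun l _ => ?_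
    rw [← mul_add]
    refine mul_le_mul_of_nonneg_left (max_le ?_ (by positivity)) (hp l)
    rw [Pi.add_apply]
    linarith [le_max_left (u l - u i) 0, le_max_left (v l - v j) 0]
  have := mul_le_mul_of_nonneg_left this hκ
  simp only [cvarFun]
  linarith

theorem cvar_smul_le (hα : 0 ≤ α) (hα' : α < 1) (hp₁ : ∑ i, p i = 1)
    {a : ℝ} (ha : 0 ≤ a) (v : ι → ℝ) : cvar α p (a • v) ≤ a * cvar α p v := by
  obtain ⟨i, hi, -⟩ := exists_cvarFun_eq_cvar hα hα' hp₁ v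
  refine (cvar_le_cvarFun hα hα' hp₁ (a • v) (a * v i)).trans_eq ?_
  rw [← hi]
  have : ∑ l, p l * max ((a • v) l - a * v i) 0 = a * ∑ l, p l * max (v l - v i) 0 := by
    rw [Finset.mul_sum]
    refine Finset.sum_congr rfl fun l _ => ?_
    rw [Pi.smul_apply, smul_eq_mul, ← mul_sub, ← mul_zero a, ← mul_max_of_nonneg _ _ ha, mul_zero]
    ring
  simp only [cvarFun, this]
  ring

/-- The conditional value-at-risk is convex; here the inequality along a line is written for a
point beyond `u`. -/
theorem le_cvar_extrapolate (hα : 0 ≤ α) (hα' : α < 1) (hp : ∀ i, 0 ≤ p i) (hp₁ : ∑ i, p i = 1)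
    (u v : ι → ℝ) {e : ℝ} (he : 0 ≤ e) :
    cvar α p u + e * (cvar α p u - cvar α p v) ≤ cvar α p (u + e • (u - v)) := by
  have h₁ : 0 < 1 + e := by linarith
  -- Subadditivity and positive homogeneity are applied to this decomposition.
  have h₂ : (1 + e) • u = (u + e • (u - v)) + e • v := by module
  have h₃ := cvar_smul_le hα hα' hp₁ (inv_nonneg.2 h₁.le) ((1 + e) • u)
  rw [smul_smul, inv_mul_cancel₀ h₁.ne', one_smul, ← div_eq_inv_mul, le_div_iff₀ h₁, h₂] at h₃
  have h₄ := cvar_add_le hα hα' hp hp₁ (u + e • (u - v)) (e • v)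
  have h₅ := cvar_smul_le hα hα' hp₁ he v
  linarith

/-- As long as the realizations keep their order, the conditional value-at-risk is affine along a
line. -/
theorem cvar_extrapolate_le (hα : 0 ≤ α) (hα' : α < 1) (hp₁ : ∑ i, p i = 1)
    {u v : ι → ℝ} {e : ℝ} {i : ι} (hu : cvarFun α p u (u i) = cvar α p u)
    (hv : cvarFun α p v (v i) = cvar α p v)
    (h : ∀ j, SignType.sign (u j - u i) = SignType.sign (v j - v i))
    (he : ∀ j, SignType.sign (u j - u i + e * (u j - u i - (v j - v i))) =
      SignType.sign (u j - u i)) :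
    cvar α p (u + e • (u - v)) ≤ cvar α p u + e * (cvar α p u - cvar α p v) := by
  -- The candidate is the common value-at-risk realization `i`, moved along the line with the
  -- others.
  refine (cvar_le_cvarFun hα hα' hp₁ _ (u i + e * (u i - v i))).trans_eq ?_
  rw [← hu, ← hv]
  have : ∑ j, p j * max ((u + e • (u - v)) j - (u i + e * (u i - v i))) 0 =
      ∑ j, p j * max (u j - u i) 0 +
        e * (∑ j, p j * max (u j - u i) 0 - ∑ j, p j * max (v j - v i) 0) := by
    rw [← Finset.sum_sub_distrib, Finset.mul_sum, ← Finset.sum_add_distrib]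
    refine Finset.sum_congr rfl fun j _ => ?_
    have e₁ : (u + e • (u - v)) j - (u i + e * (u i - v i)) =
        u j - u i + e * (u j - u i - (v j - v i)) := by
      simp only [Pi.add_apply, Pi.smul_apply, Pi.sub_apply, smul_eq_mul]
      ring
    rw [e₁, max_zero_extrapolate (h j) (he j)]
    ring
  simp only [cvarFun, this]
  ring

/-- Attainment at a realization makes CVaR a minimum of finitely many continuous functions. -/
theorem continuous_cvar (hα : 0 ≤ α) (hα' : α < 1) (hp₁ : ∑ i, p i = 1) :
    Continuous fun v : ι → ℝ => cvar α p v := by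
  have hne : (Finset.univ : Finset ι).Nonempty :=
    ⟨(exists_cvarFun_eq_cvar hα hα' hp₁ 0).choose, Finset.mem_univ _⟩
  have : (fun v : ι → ℝ => cvar α p v) =
      fun v => Finset.univ.inf' hne fun i => cvarFun α p v (v i) := by
    ext v
    obtain ⟨i, hi, hle⟩ := exists_cvarFun_eq_cvar hα hα' hp₁ v
    refine le_antisymm (Finset.le_inf' _ _ fun j _ => hle _) ?_
    rw [← hi]
    exact Finset.inf'_le _ (Finset.mem_univ i)
  rw [this]
  refine Continuous.finset_inf'_apply hne fun i _ => ?_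
  unfold cvarFun
  fun_prop

end CVaR

namespace TwoStageCVaR

variable {n₁ n₂ r d m t k : ℕ} (D : TwoStageCVaR n₁ n₂ r d m t k)

/-! ### Duality for the scenario subproblems -/

section Subproblem

variable {L : ℕ} (c : Fin L → Fin d → ℝ) (s : Fin m)

/-- The left-hand side of the dual constraints. -/
noncomputable def dualMap : Multiplier r L →ₗ[ℝ] (Fin n₂ → ℝ) where
  toFun π := (D.W s)ᵀ *ᵥ π.1 - ∑ l, π.2 l • ((D.gtil s)ᵀ *ᵥ c l)
  map_add' π π' := by
    simp only [Prod.fst_add, Prod.snd_add, Matrix.mulVec_add, Pi.add_apply, add_smul,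
      Finset.sum_add_distrib]
    abel
  map_smul' a π := by
    simp only [Prod.smul_fst, Prod.smul_snd, Matrix.mulVec_smul, Pi.smul_apply, smul_eq_mul,
      RingHom.id_apply, smul_sub, Finset.smul_sum, smul_smul]

theorem dualMap_dotProduct (π : Multiplier r L) (y : Fin n₂ → ℝ) :
    D.dualMap c s π ⬝ᵥ y =
      π.1 ⬝ᵥ (D.W s *ᵥ y) - ∑ l, π.2 l * (c l ⬝ᵥ (D.gtil s *ᵥ y)) := by
  simp only [dualMap, LinearMap.coe_mk, AddHom.coe_mk, sub_dotProduct, sum_dotProduct,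
    smul_dotProduct, smul_eq_mul, Matrix.mulVec_transpose, Matrix.dotProduct_mulVec]

/-- The slacks of the inequalities that define `dualSet`. -/
noncomputable def dualSlack (a : Fin n₂ → ℝ) (π : Multiplier r L) :
    Fin r ⊕ Fin L ⊕ Fin n₂ → ℝ :=
  Sum.elim π.1 (Sum.elim π.2 (a - D.dualMap c s π))

theorem mem_dualSet_iff_dualMap {a : Fin n₂ → ℝ} {π : Multiplier r L} :
    π ∈ D.dualSet c s a ↔ 0 ≤ π.1 ∧ 0 ≤ π.2 ∧ D.dualMap c s π ≤ a := Iff.rfl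

theorem mem_dualSet_iff {a : Fin n₂ → ℝ} {π : Multiplier r L} :
    π ∈ D.dualSet c s a ↔ ∀ i, 0 ≤ D.dualSlack c s a π i := by
  simp [mem_dualSet_iff_dualMap, dualSlack, Pi.le_def]

theorem dualSlack_extrapolate (a : Fin n₂ → ℝ) (π π' : Multiplier r L) (e : ℝ)
    (i : Fin r ⊕ Fin L ⊕ Fin n₂) :
    D.dualSlack c s a (π + e • (π - π')) i =
      D.dualSlack c s a π i + e * (D.dualSlack c s a π i - D.dualSlack c s a π' i) := by
  rcases i with i | i | i <;> simp [dualSlack]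
  ring

theorem continuous_dualMap : Continuous (D.dualMap c s) :=
  LinearMap.continuous_of_finiteDimensional _

theorem isClosed_dualSet (a : Fin n₂ → ℝ) : IsClosed (D.dualSet c s a) := by
  have : D.dualSet c s a = {π | 0 ≤ π.1} ∩ ({π | 0 ≤ π.2} ∩ {π | D.dualMap c s π ≤ a}) := rfl
  rw [this]
  exact (isClosed_le continuous_const continuous_fst).inter
    ((isClosed_le continuous_const continuous_snd).inter
      (isClosed_le (D.continuous_dualMap c s) continuous_const))

variable {c s} in
theorem smul_mem_dualSet_zero {π : Multiplier r L} (h : π ∈ D.dualSet c s 0) {a : ℝ}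
    (ha : 0 ≤ a) : a • π ∈ D.dualSet c s 0 := by
  rw [mem_dualSet_iff_dualMap] at h ⊢
  refine ⟨smul_nonneg ha h.1, smul_nonneg ha h.2.1, ?_⟩
  rw [map_smul]
  exact smul_nonpos_of_nonneg_of_nonpos ha h.2.2

/-- The sum of all multipliers. -/
noncomputable def multiplierSum (r L : ℕ) : Multiplier r L →L[ℝ] ℝ :=
  LinearMap.toContinuousLinearMap
    { toFun := fun π => ∑ i, π.1 i + ∑ l, π.2 l
      map_add' := fun π π' => by
        simp only [Prod.fst_add, Prod.snd_add, Pi.add_apply, Finset.sum_add_distrib]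
        ring
      map_smul' := fun a π => by
        simp [Finset.mul_sum, mul_add] }

theorem multiplierSum_apply (π : Multiplier r L) :
    multiplierSum r L π = ∑ i, π.1 i + ∑ l, π.2 l := rfl

/-- Multipliers are nonnegative, so bounding their sum bounds each of them. This supplies the
compact sublevel sets required by `exists_mem_extremePoints_isMaxOn`. -/
theorem isCompact_setOf_multiplierSum_le (a : Fin n₂ → ℝ) (b : ℝ) :
    IsCompact {π ∈ D.dualSet c s a | multiplierSum r L π ≤ b} := by
  have hK : IsCompact (Set.Icc (0 : Multiplier r L) (fun _ => b, fun _ => b)) := by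
    rw [← Prod.mk_zero_zero, ← Set.Icc_prod_Icc]
    exact isCompact_Icc.prod isCompact_Icc
  refine hK.of_isClosed_subset ((D.isClosed_dualSet c s a).inter
    (isClosed_le (multiplierSum r L).continuous continuous_const)) ?_
  rintro π ⟨⟨h₁, h₂, -⟩, hb⟩
  rw [multiplierSum_apply] at hb
  have hs₁ : ∀ i, π.1 i ≤ ∑ i, π.1 i := fun i =>
    Finset.single_le_sum (f := π.1) (fun i _ => h₁ i) (Finset.mem_univ i)
  have hs₂ : ∀ i, π.2 i ≤ ∑ i, π.2 i := fun i =>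
    Finset.single_le_sum (f := π.2) (fun i _ => h₂ i) (Finset.mem_univ i)
  have hn₁ : 0 ≤ ∑ i, π.1 i := Finset.sum_nonneg fun i _ => h₁ i
  have hn₂ : 0 ≤ ∑ i, π.2 i := Finset.sum_nonneg fun i _ => h₂ i
  exact ⟨⟨h₁, h₂⟩, fun i => (hs₁ i).trans (by linarith), fun i => (hs₂ i).trans (by linarith)⟩

variable (v : MasterPoint n₁ m L)

/-- The dual objective is a linear function of the multipliers. -/
noncomputable def dualObjective : Multiplier r L →L[ℝ] ℝ :=
  LinearMap.toContinuousLinearMap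
    { toFun := fun π => D.cutValue c s π v
      map_add' := fun π π' => by
        simp only [cutValue, Prod.fst_add, Prod.snd_add, add_dotProduct, Pi.add_apply, add_mul,
          Finset.sum_add_distrib]
        ring
      map_smul' := fun a π => by
        simp only [cutValue, Prod.smul_fst, Prod.smul_snd, smul_dotProduct, Pi.smul_apply,
          smul_eq_mul, RingHom.id_apply, mul_add, Finset.mul_sum, mul_assoc] }

theorem dualObjective_apply (π : Multiplier r L) :
    D.dualObjective c s v π = D.cutValue c s π v := rfl

theorem cutValue_smul (a : ℝ) (π : Multiplier r L) :
    D.cutValue c s (a • π) v = a * D.cutValue c s π v := by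
  simp only [← dualObjective_apply, map_smul, smul_eq_mul]

variable {c s v}

/-- Weak duality. With `a = D.q s` it validates optimality cuts, with `a = 0` feasibility cuts. -/
theorem cutValue_le_of_mem_dualSet {a : Fin n₂ → ℝ} {π : Multiplier r L}
    (hπ : π ∈ D.dualSet c s a) {y : Fin n₂ → ℝ} (hy : y ∈ D.subFeasible c v s) :
    D.cutValue c s π v ≤ a ⬝ᵥ y := by
  obtain ⟨h₁, h₂, h₃⟩ := (D.mem_dualSet_iff_dualMap c s).1 hπ
  obtain ⟨hy₁, hy₂, hy₃⟩ := hy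
  calc D.cutValue c s π v
      ≤ π.1 ⬝ᵥ (D.W s *ᵥ y) + ∑ l, π.2 l * -(c l ⬝ᵥ (D.gtil s *ᵥ y)) :=
        add_le_add (dotProduct_le_dotProduct_of_nonneg_left hy₂ h₁)
          (Finset.sum_le_sum fun l _ => mul_le_mul_of_nonneg_left (hy₁ l) (h₂ l))
    _ = D.dualMap c s π ⬝ᵥ y := by
        rw [dualMap_dotProduct, sub_eq_add_neg, ← Finset.sum_neg_distrib]
        simp only [mul_neg]
    _ ≤ a ⬝ᵥ y := dotProduct_le_dotProduct_of_nonneg_right h₃ hy₃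

variable (c s) in
/-- The constraints of the subproblem, written as `subRow y ≤ subRhs`. -/
noncomputable def subRow : Fin r ⊕ Fin L ⊕ Fin n₂ → (Fin n₂ → ℝ) →ₗ[ℝ] ℝ :=
  Sum.elim (fun i => -(LinearMap.proj i ∘ₗ (D.W s).mulVecLin))
    (Sum.elim
      (fun l =>
        { toFun := fun y => c l ⬝ᵥ (D.gtil s *ᵥ y)
          map_add' := fun y y' => by rw [Matrix.mulVec_add, dotProduct_add]
          map_smul' := fun a y => by rw [Matrix.mulVec_smul, dotProduct_smul]; rfl })
      (fun j => -LinearMap.proj j))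

variable (c s v) in
/-- The right-hand sides of the constraints of the subproblem. -/
noncomputable def subRhs : Fin r ⊕ Fin L ⊕ Fin n₂ → ℝ :=
  Sum.elim (fun i => -(D.h s - D.T s *ᵥ v.x) i)
    (Sum.elim (fun l => -(c l ⬝ᵥ (D.gbar s *ᵥ v.x) - v.η l - v.w s l)) 0)

theorem mem_subFeasible_iff {y : Fin n₂ → ℝ} :
    y ∈ D.subFeasible c v s ↔ ∀ i, D.subRow c s i y ≤ D.subRhs c s v i := by
  simp only [subFeasible, Set.mem_ofPred_eq, subRow, subRhs, Sum.forall, Sum.elim_inl,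
    Sum.elim_inr, LinearMap.neg_apply, LinearMap.comp_apply, LinearMap.proj_apply,
    Matrix.mulVecLin_apply, neg_le_neg_iff, LinearMap.coe_mk, AddHom.coe_mk, Pi.zero_apply,
    neg_nonpos, Pi.le_def]
  refine ⟨fun ⟨h₁, h₂, h₃⟩ => ⟨h₂, fun l => ?_, h₃⟩, fun ⟨h₂, h₁, h₃⟩ => ⟨fun l => ?_, h₂, h₃⟩⟩
  · linarith [h₁ l]
  · linarith [h₁ l]

/-- Translates Farkas multipliers of the subproblem into dual points: the multipliers of `0 ≤ y` are
the slacks of the dual inequality and disappear. -/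
theorem mem_dualSet_of_multipliers {μ : Fin r ⊕ Fin L ⊕ Fin n₂ → ℝ} (hμ : ∀ i, 0 ≤ μ i)
    {a : Fin n₂ → ℝ} (h : ∀ y, ∑ i, μ i * D.subRow c s i y = -(a ⬝ᵥ y)) :
    ((fun i => μ (.inl i), fun l => μ (.inr (.inl l))) : Multiplier r L) ∈ D.dualSet c s a ∧
      D.cutValue c s (fun i => μ (.inl i), fun l => μ (.inr (.inl l))) v =
        -∑ i, μ i * D.subRhs c s v i := by
  set π : Multiplier r L := (fun i => μ (.inl i), fun l => μ (.inr (.inl l))) with hπ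
  constructor
  · refine (D.mem_dualSet_iff_dualMap c s).2 ⟨fun i => hμ _, fun l => hμ _, ?_⟩
    have : D.dualMap c s π + (fun j => μ (.inr (.inr j))) = a := by
      refine dotProduct_eq _ _ fun y => ?_
      have := h y
      simp only [subRow, Fintype.sum_sum_type, Sum.elim_inl, Sum.elim_inr, LinearMap.neg_apply,
        LinearMap.comp_apply, LinearMap.proj_apply, Matrix.mulVecLin_apply, LinearMap.coe_mk,
        AddHom.coe_mk, mul_neg, Finset.sum_neg_distrib] at this
      rw [add_dotProduct, dualMap_dotProduct, hπ]
      simp only [dotProduct] at this ⊢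
      linarith
    rw [← this]
    exact le_add_of_nonneg_right fun j => hμ _
  · simp only [subRhs, Fintype.sum_sum_type, Sum.elim_inl, Sum.elim_inr, mul_neg,
      Finset.sum_neg_distrib, Pi.zero_apply, mul_zero, Finset.sum_const_zero, cutValue, hπ,
      dotProduct]
    ring

/-- Strong duality: a lower bound on the subproblem is proved by a dual solution. -/
theorem exists_mem_dualSet_of_forall_le (hne : (D.subFeasible c v s).Nonempty) {τ : ℝ}
    (h : ∀ y ∈ D.subFeasible c v s, τ ≤ D.q s ⬝ᵥ y) :
    ∃ π ∈ D.dualSet c s (D.q s), τ ≤ D.cutValue c s π v := by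
  obtain ⟨y₀, hy₀⟩ := hne
  obtain ⟨μ, hμ, h₁, h₂⟩ := exists_multipliers_of_forall_le (D.subRow c s) (D.subRhs c s v)
    (dotProductBilin ℝ ℝ (D.q s)) τ ⟨y₀, D.mem_subFeasible_iff.1 hy₀⟩
    fun y hy => h y (D.mem_subFeasible_iff.2 hy)
  obtain ⟨h₃, h₄⟩ := D.mem_dualSet_of_multipliers (v := v) hμ h₁
  exact ⟨_, h₃, h₄ ▸ h₂⟩

theorem exists_subOptimal (hx : v.x ∈ D.X) (hne : (D.subFeasible c v s).Nonempty) :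
    ∃ y, D.SubOptimal c v s y := by
  obtain ⟨y₀, hy₀⟩ := hne
  -- The scalarization constraints only shrink the second-stage feasible set, so its lower bound
  -- persists.
  obtain ⟨τ, hτ⟩ := D.recourse_bddBelow v.x hx s
  obtain ⟨y, hy, hmin⟩ := exists_forall_le_of_bddBelow (D.subRow c s) (D.subRhs c s v)
    (dotProductBilin ℝ ℝ (D.q s)) ⟨y₀, D.mem_subFeasible_iff.1 hy₀⟩ τ fun y hy => by
      obtain ⟨-, h₁, h₂⟩ := D.mem_subFeasible_iff.2 hy
      exact hτ ⟨y, ⟨h₂, sub_le_iff_le_add'.1 h₁⟩, rfl⟩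
  exact ⟨y, D.mem_subFeasible_iff.2 hy, fun y' hy' => hmin y' (D.mem_subFeasible_iff.1 hy')⟩

theorem cutValue_eq_of_optimal {y : Fin n₂ → ℝ} (hy : D.SubOptimal c v s y)
    {π : Multiplier r L} (hπ : D.DualOptimalVertex c v s π) :
    D.cutValue c s π v = D.q s ⬝ᵥ y := by
  obtain ⟨π', hπ', hle⟩ := D.exists_mem_dualSet_of_forall_le ⟨y, hy.1⟩ hy.2
  exact le_antisymm (D.cutValue_le_of_mem_dualSet hπ.1.1 hy.1) (hle.trans (hπ.2 π' hπ'))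

theorem exists_dualOptimalVertex {y : Fin n₂ → ℝ} (hy : D.SubOptimal c v s y) :
    ∃ π, D.DualOptimalVertex c v s π := by
  obtain ⟨π₀, hπ₀, hle⟩ := D.exists_mem_dualSet_of_forall_le ⟨y, hy.1⟩ hy.2
  obtain ⟨π, hπ, hmax⟩ := exists_mem_extremePoints_isMaxOn (D.isClosed_dualSet c s (D.q s))
    (D.dualObjective c s v) (multiplierSum r L)
    (D.isCompact_setOf_multiplierSum_le c s (D.q s)) hπ₀
    fun π hπ => (D.cutValue_le_of_mem_dualSet hπ hy.1).trans hle
  exact ⟨π, hπ, fun π' hπ' => hmax hπ'⟩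

theorem multiplierSum_nonneg {a : Fin n₂ → ℝ} {π : Multiplier r L} (hπ : π ∈ D.dualSet c s a) :
    0 ≤ multiplierSum r L π :=
  add_nonneg (Finset.sum_nonneg fun i _ => hπ.1 i) (Finset.sum_nonneg fun i _ => hπ.2.1 i)

theorem eq_zero_of_multiplierSum_eq_zero {a : Fin n₂ → ℝ} {π : Multiplier r L}
    (hπ : π ∈ D.dualSet c s a) (h : multiplierSum r L π = 0) : π = 0 := by
  have h₁ : 0 ≤ ∑ i, π.1 i := Finset.sum_nonneg fun i _ => hπ.1 i
  have h₂ : 0 ≤ ∑ i, π.2 i := Finset.sum_nonneg fun i _ => hπ.2.1 i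
  rw [multiplierSum_apply, add_eq_zero_iff_of_nonneg h₁ h₂,
    Finset.sum_eq_zero_iff_of_nonneg fun i _ => hπ.1 i,
    Finset.sum_eq_zero_iff_of_nonneg fun i _ => hπ.2.1 i] at h
  exact Prod.ext (funext fun i => h.1 i (Finset.mem_univ i))
    (funext fun i => h.2 i (Finset.mem_univ i))

/-- The alternative theorem gives some direction of positive value in the recession cone. The cone
has the compact base `multiplierSum = 1`, and a vertex of the base that maximizes the dual objective
spans an extreme ray at least as good as the normalized direction. -/
theorem exists_dualUnboundedRay (hempty : D.subFeasible c v s = ∅) :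
    ∃ π, D.DualUnboundedRay c v s π := by
  obtain ⟨μ, hμ, h₁, h₂⟩ := exists_multipliers_of_infeasible (D.subRow c s) (D.subRhs c s v) (by
    rintro ⟨y, hy⟩
    exact Set.notMem_empty y (hempty ▸ D.mem_subFeasible_iff.2 hy))
  obtain ⟨hπ₀, hval⟩ := D.mem_dualSet_of_multipliers (v := v) (a := 0) hμ fun y => by
    rw [h₁ y, zero_dotProduct, neg_zero]
  set π₀ : Multiplier r L := (fun i => μ (.inl i), fun l => μ (.inr (.inl l)))
  have hpos : 0 < D.cutValue c s π₀ v := by linarith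
  have hS₀ : 0 < multiplierSum r L π₀ := by
    refine lt_of_le_of_ne (D.multiplierSum_nonneg hπ₀) fun h => ?_
    rw [D.eq_zero_of_multiplierSum_eq_zero hπ₀ h.symm, ← dualObjective_apply, map_zero] at hpos
    exact lt_irrefl _ hpos
  set A : Set (Multiplier r L) := {π ∈ D.dualSet c s 0 | multiplierSum r L π = 1} with hA
  have hAcl : IsClosed A := (D.isClosed_dualSet c s 0).inter
    (isClosed_eq (multiplierSum r L).continuous continuous_const)
  have hAcp : ∀ b : ℝ, IsCompact {π ∈ A | multiplierSum r L π ≤ b} := fun b =>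
    (D.isCompact_setOf_multiplierSum_le c s 0 b).of_isClosed_subset
      (hAcl.inter (isClosed_le (multiplierSum r L).continuous continuous_const))
      fun π hπ => ⟨hπ.1.1, hπ.2⟩
  have hmemA : ∀ π ∈ D.dualSet c s 0, 0 < multiplierSum r L π →
      (multiplierSum r L π)⁻¹ • π ∈ A := fun π hπ h =>
    ⟨D.smul_mem_dualSet_zero hπ (inv_nonneg.2 h.le), by
      rw [map_smul, smul_eq_mul, inv_mul_cancel₀ h.ne']⟩
  have hA₀ := hmemA π₀ hπ₀ hS₀
  have hAK : IsCompact A := by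
    convert hAcp 1 using 1
    ext π
    simp only [hA, Set.mem_ofPred_eq]
    exact ⟨fun h => ⟨h, h.2.le⟩, fun h => h.1⟩
  obtain ⟨π₁, hπ₁, hmax₁⟩ := hAK.exists_isMaxOn ⟨_, hA₀⟩
    (D.dualObjective c s v).continuous.continuousOn
  obtain ⟨π, hπ, hmax⟩ := exists_mem_extremePoints_isMaxOn hAcl (D.dualObjective c s v)
    (multiplierSum r L) hAcp hπ₁ hmax₁
  have hπA : π ∈ A := hπ.1
  refine ⟨π, fun h => ?_, hπA.1, fun π₁ hπ₁ π₂ hπ₂ hsum => ?_, ?_⟩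
  · have := hπA.2
    rw [h, map_zero] at this
    exact zero_ne_one this
  · have hadd : multiplierSum r L π₁ + multiplierSum r L π₂ = 1 := by
      rw [← map_add, hsum, hπA.2]
    -- As `π` has sum one, this is the only possible factor. If both summands are nonzero, `π` is a
    -- proper convex combination of their normalizations in the base.
    refine ⟨multiplierSum r L π₁, D.multiplierSum_nonneg hπ₁, ?_⟩
    rcases (D.multiplierSum_nonneg hπ₁).eq_or_lt with h₁ | h₁
    · rw [← h₁, zero_smul]
      exact D.eq_zero_of_multiplierSum_eq_zero hπ₁ h₁.symm
    rcases (D.multiplierSum_nonneg hπ₂).eq_or_lt with h₂ | h₂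
    · rw [D.eq_zero_of_multiplierSum_eq_zero hπ₂ h₂.symm, add_zero] at hsum
      rw [hsum, hπA.2, one_smul]
    · have := (mem_extremePoints.1 hπ).2 _ (hmemA π₁ hπ₁ h₁) _ (hmemA π₂ hπ₂ h₂)
        ⟨_, _, h₁, h₂, hadd, by
          rw [smul_inv_smul₀ h₁.ne', smul_inv_smul₀ h₂.ne', hsum]⟩
      rw [← this.1, smul_inv_smul₀ h₁.ne']
  · refine lt_of_lt_of_le ?_ (hmax hA₀)
    rw [map_smul, smul_eq_mul, dualObjective_apply]
    exact mul_pos (inv_pos.2 hS₀) hpos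

/-- A dual vertex is determined by the inequalities that are tight at it. -/
theorem eq_of_sign_dualSlack_eq {a : Fin n₂ → ℝ} {π π' : Multiplier r L}
    (hπ : π ∈ Set.extremePoints ℝ (D.dualSet c s a)) (hπ' : π' ∈ D.dualSet c s a)
    (h : ∀ i, SignType.sign (D.dualSlack c s a π i) = SignType.sign (D.dualSlack c s a π' i)) :
    π' = π := by
  -- Equal tight inequalities let the segment from `π'` to `π` be prolonged beyond `π`, which an
  -- extreme point permits only if `π' = π`.
  obtain ⟨e, he, he₀⟩ := ((Filter.eventually_all.2 fun i => sign_extrapolate (h i)).and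
    self_mem_nhdsWithin).exists
  refine eq_of_mem_extremePoints_of_extrapolate hπ hπ' he₀ ((D.mem_dualSet_iff c s).2 fun i => ?_)
  rw [dualSlack_extrapolate]
  exact nonneg_of_sign_eq (he i) ((D.mem_dualSet_iff c s).1 hπ.1 i)

/-- An extreme ray of the recession cone is determined by the inequalities that are tight on it. -/
theorem cutValue_pos_of_sign_dualSlack_eq {π π' : Multiplier r L}
    (hπ : D.DualUnboundedRay c v s π) (hπ' : π' ∈ D.dualSet c s 0)
    (h : ∀ i, SignType.sign (D.dualSlack c s 0 π i) = SignType.sign (D.dualSlack c s 0 π' i)) :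
    0 < D.cutValue c s π' v := by
  obtain ⟨hne, hmem, hray, hpos⟩ := hπ
  obtain ⟨e, he, he₀⟩ := ((Filter.eventually_all.2 fun i => sign_extrapolate (h i)).and
    self_mem_nhdsWithin).exists
  have hmem' : π + e • (π - π') ∈ D.dualSet c s 0 := (D.mem_dualSet_iff c s).2 fun i => by
    rw [dualSlack_extrapolate]
    exact nonneg_of_sign_eq (he i) ((D.mem_dualSet_iff c s).1 hmem i)
  have h₁ : (0 : ℝ) < 1 + e := by linarith
  have h₂ : 0 ≤ (1 + e)⁻¹ := inv_nonneg.2 h₁.le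
  -- The prolonged point and `π'` lie in the cone, and suitable positive multiples of them add up to
  -- `π`; extremality makes `π'` a multiple of `π`.
  obtain ⟨a, ha, hea⟩ := hray ((e * (1 + e)⁻¹) • π') (D.smul_mem_dualSet_zero hπ' (by positivity))
    ((1 + e)⁻¹ • (π + e • (π - π'))) (D.smul_mem_dualSet_zero hmem' h₂) (by
      have : (1 + e)⁻¹ • (1 + e) • π = π := inv_smul_smul₀ h₁.ne' π
      refine Eq.trans ?_ this
      module)
  have hval := congrArg (fun π => D.cutValue c s π v) hea
  simp only [cutValue_smul] at hval
  have hpe : 0 < e * (1 + e)⁻¹ := by positivity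
  -- A zero factor would give `π' = 0`, and then the equal signs would give `π = 0`.
  rcases ha.eq_or_lt with rfl | ha
  · rw [zero_smul, smul_eq_zero_iff_right hpe.ne'] at hea
    refine absurd (Prod.ext (funext fun i => ?_) (funext fun l => ?_)) hne
    · have := h (.inl i)
      simpa [dualSlack, hea] using this
    · have := h (.inr (.inl l))
      simpa [dualSlack, hea] using this
  · have : 0 < e * (1 + e)⁻¹ * D.cutValue c s π' v := hval ▸ mul_pos ha hpos
    exact (mul_pos_iff_of_pos_left hpe).1 this

end Subproblem

/-! ### The separation problem -/

section Separation

theorem dotProduct_extrapolate {ι : Type*} (g : ι → Fin d → ℝ) (c c' : Fin d → ℝ) (e : ℝ) :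
    (fun i => (c + e • (c - c')) ⬝ᵥ g i) =
      (fun i => c ⬝ᵥ g i) + e • ((fun i => c ⬝ᵥ g i) - fun i => c' ⬝ᵥ g i) := by
  ext i
  simp [add_dotProduct, sub_dotProduct]

theorem exists_valueAtRiskIndex (c : Fin d → ℝ) :
    ∃ i, cvarFun D.α D.pZ (fun i => c ⬝ᵥ D.z i) (c ⬝ᵥ D.z i) = D.cvarZ c :=
  (exists_cvarFun_eq_cvar D.α_nonneg D.α_lt_one D.pZ_sum fun i => c ⬝ᵥ D.z i).imp
    fun _ h => h.1

/-- The tight inequalities of the scalarization set at `c`, the order of the scalarized benchmark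
realizations, and the realization that is the value-at-risk. -/
noncomputable def scalPattern (c : Fin d → ℝ) :
    (Fin k → SignType) × (Fin t → Fin t → SignType) × Fin t :=
  (fun j => SignType.sign (D.b j - (D.A *ᵥ c) j),
    fun i j => SignType.sign (c ⬝ᵥ D.z j - c ⬝ᵥ D.z i), (D.exists_valueAtRiskIndex c).choose)

/-- Equal patterns allow a step from `c'` through `c` to a further point of the set. Along it the
outcome CVaR is convex and the benchmark CVaR affine, so a violation larger at `c` than at `c'`
would grow further, against the maximality of `c`. -/
theorem violation_le_of_scalPattern_eq {x : Fin n₁ → ℝ} {y : Fin m → Fin n₂ → ℝ}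
    {c c' : Fin d → ℝ} (hc : D.SepOptimal x y c) (h : D.scalPattern c = D.scalPattern c') :
    D.violation x y c ≤ D.violation x y c' := by
  simp only [scalPattern, Prod.mk.injEq] at h
  obtain ⟨hA, hz, hi⟩ := h
  set i := (D.exists_valueAtRiskIndex c).choose
  have hic := (D.exists_valueAtRiskIndex c).choose_spec
  have hic' := (D.exists_valueAtRiskIndex c').choose_spec
  rw [← hi] at hic'
  obtain ⟨e, ⟨heA, hez⟩, he₀⟩ :=
    (((Filter.eventually_all.2 fun j => sign_extrapolate (congrFun hA j)).and
      (Filter.eventually_all.2 fun j => sign_extrapolate (congrFun (congrFun hz i) j))).and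
      self_mem_nhdsWithin).exists
  change 0 < e at he₀
  have hmem : c + e • (c - c') ∈ D.C := fun j => by
    rw [← sub_nonneg]
    refine nonneg_of_sign_eq ?_ (sub_nonneg.2 (hc.1 j))
    rw [← heA j]
    congr 1
    simp only [Matrix.mulVec_add, Matrix.mulVec_smul, Matrix.mulVec_sub, Pi.add_apply,
      Pi.smul_apply, Pi.sub_apply, smul_eq_mul]
    ring
  have hmax := hc.2 _ hmem
  have hG := le_cvar_extrapolate D.α_nonneg D.α_lt_one D.p_nonneg D.p_sum
    (fun s => c ⬝ᵥ D.outcome x y s) (fun s => c' ⬝ᵥ D.outcome x y s) he₀.le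
  have hZ := cvar_extrapolate_le D.α_nonneg D.α_lt_one D.pZ_sum hic hic'
    (congrFun (congrFun hz i)) hez
  rw [← dotProduct_extrapolate] at hG hZ
  simp only [violation, cvarG, cvarZ] at hmax ⊢
  have : 0 ≤ e * ((cvar D.α D.p (fun s => c' ⬝ᵥ D.outcome x y s) -
      cvar D.α D.pZ fun i => c' ⬝ᵥ D.z i) - (cvar D.α D.p (fun s => c ⬝ᵥ D.outcome x y s) -
      cvar D.α D.pZ fun i => c ⬝ᵥ D.z i)) := by linarith
  linarith [(mul_nonneg_iff_of_pos_left he₀).1 this]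

theorem continuous_violation (x : Fin n₁ → ℝ) (y : Fin m → Fin n₂ → ℝ) :
    Continuous (D.violation x y) := by
  refine ((continuous_cvar D.α_nonneg D.α_lt_one D.p_sum).comp ?_).sub
    ((continuous_cvar D.α_nonneg D.α_lt_one D.pZ_sum).comp ?_) <;>
  simp only [dotProduct] <;> fun_prop

theorem exists_sepOptimal (x : Fin n₁ → ℝ) (y : Fin m → Fin n₂ → ℝ) :
    ∃ c, D.SepOptimal x y c := by
  have hcl : IsClosed D.C :=
    isClosed_le (D.A.mulVecLin.continuous_of_finiteDimensional) continuous_const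
  have hK : IsCompact D.C := (isCompact_stdSimplex ℝ (Fin d)).of_isClosed_subset hcl D.scal_subset
  obtain ⟨c, hc, hmax⟩ := hK.exists_isMaxOn D.scal_nonempty
    (D.continuous_violation x y).continuousOn
  exact ⟨c, hc, fun c' hc' => hmax hc'⟩

end Separation

/-! ### The relaxed master problem -/

section Master

variable {D}

/-- `v.η l` is a candidate in the minimum defining CVaR, and the subproblem constraints bound the
excess over it by `v.w s l`. -/
theorem cvarG_le_cvarZ_of_subFeasible {L : ℕ} {c : Fin L → Fin d → ℝ} {v : MasterPoint n₁ m L}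
    {l : Fin L} (hw : ∀ s, 0 ≤ v.w s l)
    (hη : v.η l + (1 - D.α)⁻¹ * ∑ s, D.p s * v.w s l ≤ D.cvarZ (c l))
    {y : Fin m → Fin n₂ → ℝ} (hy : ∀ s, y s ∈ D.subFeasible c v s) :
    D.cvarG v.x y (c l) ≤ D.cvarZ (c l) := by
  refine (cvar_le_cvarFun D.α_nonneg D.α_lt_one D.p_sum _ (v.η l)).trans (le_trans ?_ hη)
  refine add_le_add le_rfl (mul_le_mul_of_nonneg_left (Finset.sum_le_sum fun s _ =>
    mul_le_mul_of_nonneg_left (max_le ?_ (hw s)) (D.p_nonneg s))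
    (inv_nonneg.2 (sub_nonneg.2 D.α_lt_one.le)))
  have := (hy s).1 l
  simp only [outcome, dotProduct_add]
  linarith

theorem mem_Y_of_subFeasible {L : ℕ} {c : Fin L → Fin d → ℝ} {v : MasterPoint n₁ m L} {s : Fin m}
    {y : Fin n₂ → ℝ} (hy : y ∈ D.subFeasible c v s) : y ∈ D.Y s v.x :=
  ⟨hy.2.2, sub_le_iff_le_add'.1 hy.2.1⟩

/-- What is known about the memory of the algorithm at any time. -/
structure IsValidState (D : TwoStageCVaR n₁ n₂ r d m t k) (σ : AlgState n₁ n₂ r d m) : Prop where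
  c_mem : ∀ l, σ.c l ∈ D.C
  optCuts_mem : ∀ a ∈ σ.optCuts, a.2 ∈ D.dualSet σ.c a.1 (D.q a.1)
  feasCuts_mem : ∀ a ∈ σ.feasCuts, a.2 ∈ D.dualSet σ.c a.1 0
  optCuts_finite : σ.optCuts.Finite
  feasCuts_finite : σ.feasCuts.Finite
  incumbent_feasible : ∀ x y, σ.incumbent = some (x, y) → D.IsFeasible x y

variable {I : D.Input} {σ : AlgState n₁ n₂ r d m}

/-- The cuts are satisfied when `θ` is the second-stage cost of a feasible decision. -/
theorem IsValidState.masterFeasible_of_subFeasible (hσ : D.IsValidState σ)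
    {v : MasterPoint n₁ m σ.L} (hx : v.x ∈ D.X) (hw : ∀ s l, 0 ≤ v.w s l)
    (hη : ∀ l, v.η l + (1 - D.α)⁻¹ * ∑ s, D.p s * v.w s l ≤ D.cvarZ (σ.c l))
    {y : Fin m → Fin n₂ → ℝ} (hy : ∀ s, y s ∈ D.subFeasible σ.c v s)
    (hθ : ∀ s, v.θ s = D.q s ⬝ᵥ y s) : D.MasterFeasible I σ v := by
  refine ⟨hx, hw, hη, fun s a ha => ?_, fun a ha => ?_, fun a ha => ?_⟩
  · rw [hθ]
    exact I.bounds_valid s a ha v.x hx (y s) (mem_Y_of_subFeasible (hy s))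
  · rw [hθ]
    exact D.cutValue_le_of_mem_dualSet (hσ.optCuts_mem a ha) (hy _)
  · simpa using D.cutValue_le_of_mem_dualSet (hσ.feasCuts_mem a ha) (hy a.1)

/-- A feasible decision gives a feasible point of the relaxed master problem with the same
objective value. -/
theorem IsValidState.exists_masterFeasible (hσ : D.IsValidState σ) (I : D.Input)
    {x : Fin n₁ → ℝ} {y : Fin m → Fin n₂ → ℝ} (hxy : D.IsFeasible x y) :
    ∃ v, D.MasterFeasible I σ v ∧ D.masterObjective v = D.objective x y := by
  obtain ⟨hx, hy, hc⟩ := hxy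
  -- Taking η at a minimizing realization and w as the exact excess makes the master constraint on η
  -- and w coincide with the CVaR constraint.
  choose i hi using fun l => exists_cvarFun_eq_cvar D.α_nonneg D.α_lt_one D.p_sum
    fun s => σ.c l ⬝ᵥ D.outcome x y s
  let η : Fin σ.L → ℝ := fun l => σ.c l ⬝ᵥ D.outcome x y (i l)
  let v : MasterPoint n₁ m σ.L :=
    { x := x
      η := η
      w := fun s l => max (σ.c l ⬝ᵥ D.outcome x y s - η l) 0
      θ := fun s => D.q s ⬝ᵥ y s }
  refine ⟨v, hσ.masterFeasible_of_subFeasible (v := v) hx (fun s l => le_max_right _ _)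
    (fun l => (hi l).1.trans_le (hc _ (hσ.c_mem l))) (y := y) (fun s => ⟨fun l => ?_, ?_, ?_⟩)
    fun s => rfl, rfl⟩
  · have : σ.c l ⬝ᵥ D.outcome x y s - η l ≤ v.w s l := le_max_left _ _
    rw [outcome, dotProduct_add] at this
    change σ.c l ⬝ᵥ (D.gbar s *ᵥ x) - η l - v.w s l ≤ _
    linarith
  · exact sub_le_iff_le_add'.2 (hy s).2
  · exact (hy s).1

end Master

end TwoStageCVaR

namespace TwoStageCVaR

variable {n₁ n₂ r d m t k : ℕ} {D : TwoStageCVaR n₁ n₂ r d m t k} {I : D.Input}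
  {σ : AlgState n₁ n₂ r d m}

/-! ### Invariants of the algorithm -/

section Invariants

/-- A zero coefficient adds no term. Only membership is kept: validity of an old cut and comparison
with a new one do not require the old multiplier to remain extreme. -/
theorem extend_mem_dualSet {L : ℕ} {c : Fin L → Fin d → ℝ} {s : Fin m} {a : Fin n₂ → ℝ}
    {π : Multiplier r L} (hπ : π ∈ D.dualSet c s a) (cnew : Fin d → ℝ) :
    π.extend ∈ D.dualSet (Fin.snoc (α := fun _ => Fin d → ℝ) c cnew) s a := by
  refine ⟨hπ.1, fun l => ?_, ?_⟩
  · refine Fin.lastCases ?_ (fun l => ?_) l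
    · simp [Multiplier.extend]
    · simpa [Multiplier.extend] using hπ.2.1 l
  · rw [Fin.sum_univ_castSucc]
    simpa [Multiplier.extend] using hπ.2.2

theorem IsValidState.newOptCuts_mem (hσ : D.IsValidState σ) {v : MasterPoint n₁ m σ.L}
    {y : Fin m → Fin n₂ → ℝ} {π : Fin m → Multiplier r σ.L}
    (hsub : D.SubproblemsSolved σ.c v y π) :
    ∀ a ∈ D.newOptCuts σ v y π, a.2 ∈ D.dualSet σ.c a.1 (D.q a.1) := by
  rintro a (ha | ⟨hne, -, ha⟩)
  · exact hσ.optCuts_mem a ha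
  · rw [ha]
    exact ((hsub a.1).1 hne).2.1.1

theorem IsValidState.newFeasCuts_mem (hσ : D.IsValidState σ) {v : MasterPoint n₁ m σ.L}
    {y : Fin m → Fin n₂ → ℝ} {π : Fin m → Multiplier r σ.L}
    (hsub : D.SubproblemsSolved σ.c v y π) :
    ∀ a ∈ D.newFeasCuts σ v π, a.2 ∈ D.dualSet σ.c a.1 0 := by
  rintro a (ha | ⟨he, ha⟩)
  · exact hσ.feasCuts_mem a ha
  · rw [ha]
    exact ((hsub a.1).2 he).2.1

theorem IsValidState.newOptCuts_finite (hσ : D.IsValidState σ) (v : MasterPoint n₁ m σ.L)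
    (y : Fin m → Fin n₂ → ℝ) (π : Fin m → Multiplier r σ.L) :
    (D.newOptCuts σ v y π).Finite :=
  hσ.optCuts_finite.union ((Set.finite_range fun s => (s, π s)).subset
    fun a ha => ⟨a.1, Prod.ext rfl ha.2.2.symm⟩)

theorem IsValidState.newFeasCuts_finite (hσ : D.IsValidState σ) (v : MasterPoint n₁ m σ.L)
    (π : Fin m → Multiplier r σ.L) : (D.newFeasCuts σ v π).Finite :=
  hσ.feasCuts_finite.union ((Set.finite_range fun s => (s, π s)).subset
    fun a ha => ⟨a.1, Prod.ext rfl ha.2.symm⟩)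

/-- What is known about the configurations of the algorithm; a report is correct. -/
def IsValidConfig (I : D.Input) : AlgConfig n₁ n₂ r d m → Prop
  | .running σ => D.IsValidState σ
  | .infeasible => ∀ x y, ¬ D.IsFeasible x y
  | .optimal x y => D.IsOptimalWithin I.ε x y

theorem IsValidState.isOptimalWithin (hσ : D.IsValidState σ) {v : MasterPoint n₁ m σ.L}
    (hv : D.MasterOptimal I σ v) {x : Fin n₁ → ℝ} {y : Fin m → Fin n₂ → ℝ}
    (htest : D.StopsWith I σ v x y) : D.IsOptimalWithin I.ε x y := by
  refine ⟨hσ.incumbent_feasible x y htest.1, fun x' y' hxy' => ?_⟩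
  obtain ⟨v', hv', hobj⟩ := hσ.exists_masterFeasible I hxy'
  have h₁ := hv.2 v' hv'
  have h₂ := (abs_le.1 htest.2).1
  linarith

theorem IsValidConfig.step {κ κ' : AlgConfig n₁ n₂ r d m} (h : D.Step I κ κ')
    (hκ : IsValidConfig I κ) : IsValidConfig I κ' := by
  cases h with
  | infeasible σ hinf =>
    intro x y hxy
    obtain ⟨v, hv, -⟩ := IsValidState.exists_masterFeasible hκ I hxy
    exact hinf v hv
  | terminate σ v hv x y htest => exact IsValidState.isOptimalWithin hκ hv htest
  | cutOnly σ v hv hns y π hsub hinf =>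
    exact
      { c_mem := hκ.c_mem
        optCuts_mem := IsValidState.newOptCuts_mem hκ hsub
        feasCuts_mem := IsValidState.newFeasCuts_mem hκ hsub
        optCuts_finite := IsValidState.newOptCuts_finite hκ v y π
        feasCuts_finite := IsValidState.newFeasCuts_finite hκ v π
        incumbent_feasible := hκ.incumbent_feasible }
  | improve σ v hv hns y π hsub hfeas cstar hc hle =>
    exact
      { c_mem := hκ.c_mem
        optCuts_mem := IsValidState.newOptCuts_mem hκ hsub
        feasCuts_mem := IsValidState.newFeasCuts_mem hκ hsub
        optCuts_finite := IsValidState.newOptCuts_finite hκ v y π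
        feasCuts_finite := IsValidState.newFeasCuts_finite hκ v π
        incumbent_feasible := by
          rintro x' y' heq
          obtain ⟨rfl, rfl⟩ := Prod.mk.inj (Option.some.inj heq)
          exact ⟨hv.1.1, fun s => mem_Y_of_subFeasible ((hsub s).1 (hfeas s)).1.1,
            fun c hcC => sub_nonpos.1 ((hc.2 c hcC).trans hle)⟩ }
  | addColumn σ v hv hns y π hsub hfeas cstar hc hpos =>
    exact
      { c_mem := fun l => by
          refine Fin.lastCases ?_ (fun l => ?_) l
          · simpa using hc.1
          · simpa using hκ.c_mem l
        optCuts_mem := by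
          rintro _ ⟨a, ha, rfl⟩
          exact extend_mem_dualSet (IsValidState.newOptCuts_mem hκ hsub a ha) cstar
        feasCuts_mem := by
          rintro _ ⟨a, ha, rfl⟩
          exact extend_mem_dualSet (IsValidState.newFeasCuts_mem hκ hsub a ha) cstar
        optCuts_finite := (IsValidState.newOptCuts_finite hκ v y π).image _
        feasCuts_finite := (IsValidState.newFeasCuts_finite hκ v π).image _
        incumbent_feasible := hκ.incumbent_feasible }

theorem isValidConfig_start (I : D.Input) : IsValidConfig I (D.start I) :=
  { c_mem := I.c₀_mem
    optCuts_mem := fun _ h => h.elim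
    feasCuts_mem := fun _ h => h.elim
    optCuts_finite := Set.finite_empty
    feasCuts_finite := Set.finite_empty
    incumbent_feasible := fun _ _ h => nomatch h }

theorem IsValidConfig.of_reachable {κ : AlgConfig n₁ n₂ r d m} (h : D.Reachable I κ) :
    IsValidConfig I κ := by
  induction h with
  | refl => exact isValidConfig_start I
  | tail _ hs ih => exact ih.step hs

end Invariants

/-! ### Termination -/

section Termination

/-- The dual inequalities that are tight at the multiplier of a cut. -/
noncomputable def cutPattern (D : TwoStageCVaR n₁ n₂ r d m t k) {L : ℕ} (c : Fin L → Fin d → ℝ)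
    (q : Fin m → Fin n₂ → ℝ) (a : Fin m × Multiplier r L) :
    Fin m × (Fin r ⊕ Fin L ⊕ Fin n₂ → SignType) :=
  (a.1, fun i => SignType.sign (D.dualSlack c a.1 (q a.1) a.2 i))

/-- The number of different patterns of the scalarization vectors. -/
noncomputable def scalCount (D : TwoStageCVaR n₁ n₂ r d m t k) (σ : AlgState n₁ n₂ r d m) : ℕ :=
  (Set.range fun l => D.scalPattern (σ.c l)).ncard

/-- The number of different patterns of the cuts. -/
noncomputable def cutCount (D : TwoStageCVaR n₁ n₂ r d m t k) {L : ℕ} (c : Fin L → Fin d → ℝ)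
    (optCuts feasCuts : Set (Fin m × Multiplier r L)) : ℕ :=
  (D.cutPattern c D.q '' optCuts).ncard + (D.cutPattern c 0 '' feasCuts).ncard

theorem ncard_image_lt_ncard_image {A B : Type*} [Finite B] {f : A → B} {S S' : Set A}
    (hS : S ⊆ S') {x : A} (hx : x ∈ S') (hnew : ∀ a ∈ S, f x ≠ f a) :
    (f '' S).ncard < (f '' S').ncard :=
  Set.ncard_lt_ncard ((Set.ssubset_iff_of_subset (Set.image_mono hS)).2
    ⟨f x, Set.mem_image_of_mem f hx, fun ⟨a, ha, hax⟩ => hnew a ha hax.symm⟩)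

variable {v : MasterPoint n₁ m σ.L} {y : Fin m → Fin n₂ → ℝ} {π : Fin m → Multiplier r σ.L}

/-- An old feasibility cut with the pattern of the new ray would already be violated at `v`. -/
theorem IsValidState.cutCount_lt_of_infeasible (hσ : D.IsValidState σ)
    (hv : D.MasterFeasible I σ v) (hsub : D.SubproblemsSolved σ.c v y π)
    (hinf : ∃ s, D.subFeasible σ.c v s = ∅) :
    D.cutCount σ.c σ.optCuts σ.feasCuts <
      D.cutCount σ.c (D.newOptCuts σ v y π) (D.newFeasCuts σ v π) := by
  obtain ⟨s, hs⟩ := hinf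
  refine add_lt_add_of_le_of_lt
    (Set.ncard_le_ncard (Set.image_mono Set.subset_union_left)) ?_
  refine ncard_image_lt_ncard_image Set.subset_union_left (x := (s, π s)) (.inr ⟨hs, rfl⟩)
    fun a ha heq => ?_
  obtain ⟨s', π'⟩ := a
  simp only [cutPattern, Prod.mk.injEq] at heq
  obtain ⟨rfl, heq⟩ := heq
  have := D.cutValue_pos_of_sign_dualSlack_eq ((hsub s).2 hs) (hσ.feasCuts_mem _ ha)
    (congrFun heq)
  exact absurd (hv.2.2.2.2.2 _ ha) (not_le.2 this)

/-- An old optimality cut with the pattern of the new vertex would have the same multiplier, and by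
strong duality would force `v.θ s` up to the subproblem value. -/
theorem IsValidState.cutCount_lt_of_lt (hσ : D.IsValidState σ)
    (hv : D.MasterFeasible I σ v) (hsub : D.SubproblemsSolved σ.c v y π) {s : Fin m}
    (hs : (D.subFeasible σ.c v s).Nonempty) (hlt : v.θ s < D.q s ⬝ᵥ y s) :
    D.cutCount σ.c σ.optCuts σ.feasCuts <
      D.cutCount σ.c (D.newOptCuts σ v y π) (D.newFeasCuts σ v π) := by
  refine add_lt_add_of_lt_of_le ?_
    (Set.ncard_le_ncard (Set.image_mono Set.subset_union_left))
  refine ncard_image_lt_ncard_image Set.subset_union_left (x := (s, π s)) (.inr ⟨hs, hlt, rfl⟩)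
    fun a ha heq => ?_
  obtain ⟨s', π'⟩ := a
  simp only [cutPattern, Prod.mk.injEq] at heq
  obtain ⟨rfl, heq⟩ := heq
  obtain ⟨hy, hπ⟩ := (hsub s).1 hs
  have := D.eq_of_sign_dualSlack_eq hπ.1 (hσ.optCuts_mem _ ha) (congrFun heq)
  rw [← D.cutValue_eq_of_optimal hy hπ, ← this] at hlt
  exact absurd (hv.2.2.2.2.1 _ ha) (not_le.2 hlt)

theorem scalPattern_ne_of_violation_pos (hv : D.MasterFeasible I σ v)
    (hy : ∀ s, y s ∈ D.subFeasible σ.c v s) {c : Fin d → ℝ} (hc : D.SepOptimal v.x y c)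
    (hpos : 0 < D.violation v.x y c) (l : Fin σ.L) : D.scalPattern c ≠ D.scalPattern (σ.c l) := by
  intro h
  have h₁ := D.violation_le_of_scalPattern_eq hc h
  have h₂ : D.violation v.x y (σ.c l) ≤ 0 := sub_nonpos.2
    (cvarG_le_cvarZ_of_subFeasible (fun s => hv.2.1 s l) (hv.2.2.1 l) hy)
  linarith

/-- The stopping test will succeed. -/
def WillStop (I : D.Input) (σ : AlgState n₁ n₂ r d m) : Prop :=
  ∀ v, D.MasterOptimal I σ v → ∃ x y, D.StopsWith I σ v x y

/-- If no cut is generated, then the solution of the master problem and the solutions of the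
subproblems have the same objective value. -/
theorem IsValidState.masterObjective_eq_objective (hσ : D.IsValidState σ)
    (hv : D.MasterOptimal I σ v) (hy : ∀ s, y s ∈ D.subFeasible σ.c v s)
    (hθ : ∀ s, D.q s ⬝ᵥ y s ≤ v.θ s) : D.masterObjective v = D.objective v.x y := by
  refine le_antisymm ?_ (add_le_add le_rfl
    (Finset.sum_le_sum fun s _ => mul_le_mul_of_nonneg_left (hθ s) (D.p_nonneg s)))
  -- Lowering θ to the subproblem values keeps the point feasible. Only the weighted sums are
  -- compared, since θ is not determined in scenarios of probability zero.
  exact hv.2 { v with θ := fun s => D.q s ⬝ᵥ y s }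
    (hσ.masterFeasible_of_subFeasible (v := { v with θ := fun s => D.q s ⬝ᵥ y s })
      hv.1.1 hv.1.2.1 hv.1.2.2.1 (y := y) hy fun s => rfl)

/-- With no new cut the next master problem has the same optimal value, which is now the upper
bound, so the test succeeds even for tolerance zero. -/
theorem IsValidState.willStop_improve (hσ : D.IsValidState σ) (hv : D.MasterOptimal I σ v)
    (hy : ∀ s, y s ∈ D.subFeasible σ.c v s) (hθ : ∀ s, D.q s ⬝ᵥ y s ≤ v.θ s)
    {optCuts feasCuts : Set (Fin m × Multiplier r σ.L)}
    (hopt : optCuts = σ.optCuts) (hfeas : feasCuts = σ.feasCuts) :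
    WillStop I { L := σ.L, c := σ.c, optCuts := optCuts, feasCuts := feasCuts,
                 incumbent := some (v.x, y) } := by
  subst hopt hfeas
  intro v' hv'
  have heq : D.masterObjective v' = D.masterObjective v :=
    le_antisymm (hv'.2 v hv.1) (hv.2 v' hv'.1)
  refine ⟨v.x, y, rfl, ?_⟩
  rw [heq, hσ.masterObjective_eq_objective hv hy hθ, sub_self, abs_zero]
  exact mul_nonneg I.ε_nonneg (abs_nonneg _)

open Classical in
/-- A quantity that decreases in every iteration. -/
noncomputable def progress (I : D.Input) (σ : AlgState n₁ n₂ r d m) : ℕ ×ₗ ℕ ×ₗ ℕ :=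
  -- Lexicographic order is needed because a new vector changes the space of cut patterns. The
  -- factor `2` accounts for the two kinds of cuts, and the final flag for the one iteration that
  -- only records an incumbent.
  toLex (Nat.card ((Fin k → SignType) × (Fin t → Fin t → SignType) × Fin t) - D.scalCount σ,
    toLex (2 * Nat.card (Fin m × (Fin r ⊕ Fin σ.L ⊕ Fin n₂ → SignType)) -
      D.cutCount σ.c σ.optCuts σ.feasCuts, if WillStop I σ then 0 else 1))

theorem cutCount_le {L : ℕ} (c : Fin L → Fin d → ℝ)
    (optCuts feasCuts : Set (Fin m × Multiplier r L)) :
    D.cutCount c optCuts feasCuts ≤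
      2 * Nat.card (Fin m × (Fin r ⊕ Fin L ⊕ Fin n₂ → SignType)) := by
  rw [two_mul]
  exact add_le_add (Set.ncard_le_card _) (Set.ncard_le_card _)

theorem progress_lt_of_cutCount_lt {optCuts feasCuts : Set (Fin m × Multiplier r σ.L)}
    (h : D.cutCount σ.c σ.optCuts σ.feasCuts < D.cutCount σ.c optCuts feasCuts)
    (inc : Option ((Fin n₁ → ℝ) × (Fin m → Fin n₂ → ℝ))) :
    progress I { L := σ.L, c := σ.c, optCuts := optCuts, feasCuts := feasCuts,
                 incumbent := inc } < progress I σ := by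
  refine Prod.Lex.toLex_lt_toLex.2 (.inr ⟨rfl, Prod.Lex.toLex_lt_toLex.2 (.inl ?_)⟩)
  exact Nat.sub_lt_sub_left (h.trans_le (cutCount_le _ _ _)) h

theorem progress_lt_of_step {σ' : AlgState n₁ n₂ r d m} (hσ : D.IsValidState σ)
    (h : D.Step I (.running σ) (.running σ')) : progress I σ' < progress I σ := by
  cases h with
  | cutOnly _ v hv hns y π hsub hinf =>
    exact progress_lt_of_cutCount_lt (hσ.cutCount_lt_of_infeasible hv.1 hsub hinf) _
  | improve _ v hv hns y π hsub hfeas cstar hc hle =>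
    -- Either some estimate is too low and a cut with a new pattern appears, or only the flag drops:
    -- the test has just failed and is now bound to succeed.
    by_cases hlt : ∃ s, v.θ s < D.q s ⬝ᵥ y s
    · obtain ⟨s, hs⟩ := hlt
      exact progress_lt_of_cutCount_lt (hσ.cutCount_lt_of_lt hv.1 hsub (hfeas s) hs) _
    · push Not at hlt
      have hopt : D.newOptCuts σ v y π = σ.optCuts :=
        Set.union_eq_left.2 fun a ha => absurd ha.2.1 (not_lt.2 (hlt _))
      have hfea : D.newFeasCuts σ v π = σ.feasCuts :=
        Set.union_eq_left.2 fun a ha => absurd ha.1 (hfeas _).ne_empty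
      have htest := hσ.willStop_improve hv (fun s => ((hsub s).1 (hfeas s)).1.1) hlt hopt hfea
      have hnot : ¬ WillStop I σ := fun h => by
        obtain ⟨x', y', h'⟩ := h v hv
        exact hns x' y' h'
      refine Prod.Lex.toLex_lt_toLex.2 (.inr ⟨rfl, Prod.Lex.toLex_lt_toLex.2 (.inr ⟨?_, ?_⟩)⟩)
      · simp only [hopt, hfea]
      · dsimp only
        rw [if_pos htest, if_neg hnot]
        exact zero_lt_one
  | addColumn _ v hv hns y π hsub hfeas cstar hc hpos =>
    -- Subtraction is truncated, so it must also be shown that the old count was below the total;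
    -- the pattern of `cstar` was missing.
    refine Prod.Lex.toLex_lt_toLex.2 (.inl (Nat.sub_lt_sub_left ?_ ?_))
    all_goals
      have hnew := scalPattern_ne_of_violation_pos hv.1
        (fun s => ((hsub s).1 (hfeas s)).1.1) hc hpos
    · refine (Set.ncard_lt_ncard (t := Set.univ) (Set.ssubset_univ_iff.2 fun h => ?_)).trans_eq
        (Set.ncard_univ _)
      obtain ⟨l, hl⟩ := h.symm ▸ Set.mem_univ (D.scalPattern cstar)
      exact hnew l hl.symm
    · refine Set.ncard_lt_ncard ((Set.ssubset_iff_of_subset ?_).2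
        ⟨D.scalPattern cstar, ⟨Fin.last _, by simp⟩, fun ⟨l, hl⟩ => hnew l hl.symm⟩)
      rintro _ ⟨l, rfl⟩
      exact ⟨l.castSucc, by simp⟩

theorem not_exists_infinite_execution (I : D.Input) :
    ¬ ∃ κ : ℕ → AlgConfig n₁ n₂ r d m, κ 0 = D.start I ∧ ∀ i, D.Step I (κ i) (κ (i + 1)) := by
  rintro ⟨κ, h₀, hstep⟩
  -- Reports have no successor, so every configuration of an infinite execution is running.
  have hrun : ∀ i, ∃ σ, κ i = .running σ := fun i => by
    have := hstep i
    generalize κ i = a, κ (i + 1) = b at this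
    cases this <;> exact ⟨_, rfl⟩
  choose σ hσ using hrun
  have hreach : ∀ i, D.Reachable I (κ i) := fun i => by
    induction i with
    | zero => rw [h₀]; exact Relation.ReflTransGen.refl
    | succ i ih => exact ih.tail (hstep i)
  have hlt : ∀ i, progress I (σ (i + 1)) < progress I (σ i) := fun i => by
    have hval : IsValidConfig I (.running (σ i)) := hσ i ▸ IsValidConfig.of_reachable (hreach i)
    refine progress_lt_of_step hval ?_
    rw [← hσ, ← hσ]
    exact hstep i
  obtain ⟨_, ⟨i, rfl⟩, hmin⟩ := wellFounded_lt.has_min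
    (Set.range fun i => progress I (σ i)) (Set.range_nonempty _)
  exact hmin _ ⟨i + 1, rfl⟩ (hlt i)

end Termination

/-! ### Progress -/

theorem exists_step
    (hopt : (∃ v, D.MasterFeasible I σ v) → ∃ v, D.MasterOptimal I σ v) :
    ∃ κ, D.Step I (.running σ) κ := by
  by_cases hne : ∃ v, D.MasterFeasible I σ v
  swap
  · exact ⟨_, .infeasible σ (not_exists.1 hne)⟩
  obtain ⟨v, hv⟩ := hopt hne
  by_cases htest : ∃ x y, D.StopsWith I σ v x y
  · obtain ⟨x, y, h⟩ := htest
    exact ⟨_, .terminate σ v hv x y h⟩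
  push Not at htest
  have hsolve : ∀ s, ∃ (y : Fin n₂ → ℝ) (π : Multiplier r σ.L),
      ((D.subFeasible σ.c v s).Nonempty → D.SubOptimal σ.c v s y ∧ D.DualOptimalVertex σ.c v s π) ∧
        (D.subFeasible σ.c v s = ∅ → D.DualUnboundedRay σ.c v s π) := fun s => by
    rcases (D.subFeasible σ.c v s).eq_empty_or_nonempty with he | he
    · obtain ⟨π, hπ⟩ := D.exists_dualUnboundedRay he
      exact ⟨0, π, fun h => absurd he h.ne_empty, fun _ => hπ⟩
    · obtain ⟨y, hy⟩ := D.exists_subOptimal hv.1.1 he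
      obtain ⟨π, hπ⟩ := D.exists_dualOptimalVertex hy
      exact ⟨y, π, fun _ => ⟨hy, hπ⟩, fun h => absurd h he.ne_empty⟩
  choose y π hsub using hsolve
  by_cases hinf : ∃ s, D.subFeasible σ.c v s = ∅
  · exact ⟨_, .cutOnly σ v hv htest y π hsub hinf⟩
  have hfeas : ∀ s, (D.subFeasible σ.c v s).Nonempty := fun s =>
    Set.nonempty_iff_ne_empty.2 fun h => hinf ⟨s, h⟩
  obtain ⟨c, hc⟩ := D.exists_sepOptimal v.x y
  rcases le_or_gt (D.violation v.x y c) 0 with h | h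
  · exact ⟨_, .improve σ v hv htest y π hsub hfeas c hc h⟩
  · exact ⟨_, .addColumn σ v hv htest y π hsub hfeas c hc h⟩

/-! ### Solvability of the relaxed master problem -/

section MasterSolvable

/-- Separates the first-stage decision, treated below as a parameter, from the linear part in η and
w. -/
theorem cutValue_eq_sub {L : ℕ} (c : Fin L → Fin d → ℝ) (s : Fin m) (π : Multiplier r L)
    (v : MasterPoint n₁ m L) :
    D.cutValue c s π v =
      D.cutValue c s π ⟨v.x, 0, 0, 0⟩ - ∑ l, π.2 l * (v.η l + v.w s l) := by
  simp only [cutValue, Pi.zero_apply, sub_zero, add_sub_assoc, ← Finset.sum_sub_distrib]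
  congr 1
  exact Finset.sum_congr rfl fun l _ => by ring

theorem continuous_cutValue {L : ℕ} (c : Fin L → Fin d → ℝ) (s : Fin m) (π : Multiplier r L) :
    Continuous fun x : Fin n₁ → ℝ => D.cutValue c s π ⟨x, 0, 0, 0⟩ := by
  have hT : Continuous fun x : Fin n₁ → ℝ => D.T s *ᵥ x :=
    (D.T s).mulVecLin.continuous_of_finiteDimensional
  have hg : Continuous fun x : Fin n₁ → ℝ => D.gbar s *ᵥ x :=
    (D.gbar s).mulVecLin.continuous_of_finiteDimensional
  simp only [cutValue, dotProduct]
  fun_prop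

/-- The pairs of a first-stage decision and a bound on the expected second-stage cost that are
feasible for the master problem are described by a closed set. -/
theorem exists_isClosed_projection (I : D.Input) (σ : AlgState n₁ n₂ r d m)
    (hopt : σ.optCuts.Finite) (hfeas : σ.feasCuts.Finite) :
    ∃ Q : Set ((Fin n₁ → ℝ) × ℝ), IsClosed Q ∧ ∀ x ∈ D.X, ∀ τ,
      (x, τ) ∈ Q ↔ ∃ v, D.MasterFeasible I σ v ∧ v.x = x ∧ ∑ s, D.p s * v.θ s ≤ τ := by
  let V := (Fin σ.L → ℝ) × (Fin m → Fin σ.L → ℝ) × (Fin m → ℝ)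
  let η : Fin σ.L → V →ₗ[ℝ] ℝ := fun l => LinearMap.proj l ∘ₗ LinearMap.fst ℝ _ _
  let w : Fin m → Fin σ.L → V →ₗ[ℝ] ℝ := fun s l =>
    LinearMap.proj l ∘ₗ LinearMap.proj s ∘ₗ LinearMap.fst ℝ _ _ ∘ₗ LinearMap.snd ℝ _ _
  let θ : Fin m → V →ₗ[ℝ] ℝ := fun s =>
    LinearMap.proj s ∘ₗ LinearMap.snd ℝ _ _ ∘ₗ LinearMap.snd ℝ _ _
  have hη_apply : ∀ l u, η l u = u.1 l := fun _ _ => rfl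
  have hw_apply : ∀ s l u, w s l u = u.2.1 s l := fun _ _ _ => rfl
  have hθ_apply : ∀ s u, θ s u = u.2.2 s := fun _ _ => rfl
  let E := (Fin n₁ → ℝ) × ℝ
  let cut : Fin m × Multiplier r σ.L → C(E, ℝ) := fun a =>
    ⟨fun e => -D.cutValue σ.c a.1 a.2 ⟨e.1, 0, 0, 0⟩,
      ((D.continuous_cutValue σ.c a.1 a.2).comp continuous_fst).neg⟩
  let bound : (Fin n₁ → ℝ) × ℝ → C(E, ℝ) := fun a =>
    ⟨fun e : (Fin n₁ → ℝ) × ℝ => -(a.1 ⬝ᵥ e.1 + a.2), by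
      have h : Continuous fun e : (Fin n₁ → ℝ) × ℝ => -(a.1 ⬝ᵥ e.1 + a.2) := by
        simp only [dotProduct]
        fun_prop
      exact h⟩
  let slope : Fin m × Multiplier r σ.L → V →ₗ[ℝ] ℝ := fun a =>
    -∑ l, a.2.2 l • (η l + w a.1 l)
  -- The master constraints as a linear system in (η, w, θ), with right-hand sides continuous in the
  -- parameter `(x, τ)`; the last member bounds the expected estimate by `τ`. Membership in `X`
  -- stays outside, as `X` need not be polyhedral.
  let S : Set ((V →ₗ[ℝ] ℝ) × C(E, ℝ)) :=
    Set.range (fun a : Fin m × Fin σ.L => (-w a.1 a.2, 0)) ∪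
    (Set.range (fun l => (η l + (1 - D.α)⁻¹ • ∑ s, D.p s • w s l,
      ContinuousMap.const E (D.cvarZ (σ.c l)))) ∪
    ((⋃ s, (fun a => (-θ s, bound a)) '' {a | a ∈ I.bounds s}) ∪
    ((fun a => (slope a - θ a.1, cut a)) '' σ.optCuts ∪
    ((fun a => (slope a, cut a)) '' σ.feasCuts ∪
    {(∑ s, D.p s • θ s, ⟨Prod.snd, continuous_snd⟩)}))))
  have hS : S.Finite :=
    (Set.finite_range _).union ((Set.finite_range _).union
      ((Set.finite_iUnion fun s => (List.finite_toSet (I.bounds s)).image _).union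
        ((hopt.image _).union ((hfeas.image _).union (Set.finite_singleton _)))))
  have hmem : ∀ (e : E) (u : V), (∀ a ∈ S, a.1 u ≤ a.2 e) ↔
      (∀ s l, 0 ≤ u.2.1 s l) ∧
      (∀ l, u.1 l + (1 - D.α)⁻¹ * ∑ s, D.p s * u.2.1 s l ≤ D.cvarZ (σ.c l)) ∧
      (∀ s, ∀ a ∈ I.bounds s, a.1 ⬝ᵥ e.1 + a.2 ≤ u.2.2 s) ∧
      (∀ a ∈ σ.optCuts, D.cutValue σ.c a.1 a.2 ⟨e.1, u.1, u.2.1, u.2.2⟩ ≤ u.2.2 a.1) ∧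
      (∀ a ∈ σ.feasCuts, D.cutValue σ.c a.1 a.2 ⟨e.1, u.1, u.2.1, u.2.2⟩ ≤ 0) ∧
      ∑ s, D.p s * u.2.2 s ≤ e.2 := by
    intro e u
    have hslope : ∀ a, slope a u = -∑ l, a.2.2 l * (u.1 l + u.2.1 a.1 l) := fun a => by
      simp [slope, hη_apply, hw_apply, mul_add]
    simp only [S, Set.mem_union, or_imp, forall_and, Set.forall_mem_range, Set.forall_mem_image,
      Set.mem_iUnion, forall_exists_index, Set.mem_singleton_iff, forall_eq]
    refine and_congr ?_ (and_congr ?_ (and_congr ?_ (and_congr ?_ (and_congr ?_ ?_))))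
    · simp [hw_apply, Prod.forall]
    · simp [hη_apply, hw_apply]
    · constructor
      · intro h s a ha
        have := h _ s ⟨a, ha, rfl⟩
        exact neg_le_neg_iff.1 this
      · rintro h _ s ⟨a, ha, rfl⟩
        exact neg_le_neg (h s a ha)
    · refine forall₂_congr fun a _ => ?_
      rw [cutValue_eq_sub, LinearMap.sub_apply, hslope]
      change _ - u.2.2 a.1 ≤ -D.cutValue σ.c a.1 a.2 ⟨e.1, 0, 0, 0⟩ ↔ _
      constructor <;> intro h <;> linarith
    · refine forall₂_congr fun a _ => ?_
      rw [cutValue_eq_sub, hslope]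
      change _ ≤ -D.cutValue σ.c a.1 a.2 ⟨e.1, 0, 0, 0⟩ ↔ _
      constructor <;> intro h <;> linarith
    · simp [hθ_apply]
  refine ⟨_, hS.isClosed_setOf_exists_forall_le, fun x hx τ => ?_⟩
  constructor
  · rintro ⟨u, hu⟩
    obtain ⟨h₁, h₂, h₃, h₄, h₅, h₆⟩ := (hmem (x, τ) u).1 hu
    exact ⟨⟨x, u.1, u.2.1, u.2.2⟩, ⟨hx, h₁, h₂, h₃, h₄, h₅⟩, rfl, h₆⟩
  · rintro ⟨v, ⟨-, h₁, h₂, h₃, h₄, h₅⟩, rfl, h₆⟩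
    exact ⟨(v.η, v.w, v.θ), (hmem _ _).2 ⟨h₁, h₂, h₃, h₄, h₅, h₆⟩⟩

theorem IsValidState.exists_masterOptimal (hσ : D.IsValidState σ) (hX : IsCompact D.X)
    (hf : LowerSemicontinuousOn D.f D.X) (hbounds : ∀ s, I.bounds s ≠ [])
    (hne : ∃ v, D.MasterFeasible I σ v) : ∃ v, D.MasterOptimal I σ v := by
  obtain ⟨v₀, hv₀⟩ := hne
  obtain ⟨Q, hQ, hQmem⟩ := exists_isClosed_projection I σ hσ.optCuts_finite hσ.feasCuts_finite
  choose a ha using fun s => List.exists_mem_of_ne_nil _ (hbounds s)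
  have hcont : Continuous fun x : Fin n₁ → ℝ => ∑ s, D.p s * ((a s).1 ⬝ᵥ x + (a s).2) := by
    simp only [dotProduct]
    fun_prop
  obtain ⟨x₁, -, hx₁⟩ := hX.exists_isMinOn ⟨v₀.x, hv₀.1⟩ hcont.continuousOn
  obtain ⟨x₂, hx₂X, hx₂⟩ := hf.exists_isMinOn ⟨v₀.x, hv₀.1⟩ hX
  -- The variables η, w and θ may be unbounded, so compactness is sought only for the pair of `x`
  -- and the expected estimate. The initial bounds give `lo`; an estimate above `hi` makes the
  -- objective exceed that of `v₀`, because `x₂` minimizes `f`.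
  set lo := ∑ s, D.p s * ((a s).1 ⬝ᵥ x₁ + (a s).2)
  set hi := D.masterObjective v₀ - D.f x₂ with hhi
  set K : Set ((Fin n₁ → ℝ) × ℝ) := (D.X ×ˢ Set.Icc lo hi) ∩ Q
  have hK : IsCompact K := (hX.prod isCompact_Icc).inter_right hQ
  have hlo : ∀ v, D.MasterFeasible I σ v → lo ≤ ∑ s, D.p s * v.θ s := fun v hv =>
    (hx₁ hv.1).trans (Finset.sum_le_sum fun s _ =>
      mul_le_mul_of_nonneg_left (hv.2.2.2.1 s (a s) (ha s)) (D.p_nonneg s))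
  have hmemK : ∀ v, D.MasterFeasible I σ v → ∑ s, D.p s * v.θ s ≤ hi →
      (v.x, ∑ s, D.p s * v.θ s) ∈ K := fun v hv h =>
    ⟨⟨hv.1, hlo v hv, h⟩, (hQmem _ hv.1 _).2 ⟨v, hv, rfl, le_rfl⟩⟩
  have h₀ : (v₀.x, ∑ s, D.p s * v₀.θ s) ∈ K := hmemK v₀ hv₀ (by
    rw [hhi, masterObjective]
    linarith [isMinOn_iff.1 hx₂ _ hv₀.1])
  have hlsc : LowerSemicontinuousOn (fun e : (Fin n₁ → ℝ) × ℝ => D.f e.1 + e.2) K :=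
    (hf.comp continuous_fst.continuousOn fun e he => he.1.1).add
      continuous_snd.continuousOn.lowerSemicontinuousOn
  obtain ⟨⟨x, τ⟩, hxτ, hmin⟩ := hlsc.exists_isMinOn ⟨_, h₀⟩ hK
  obtain ⟨v, hv, rfl, hvτ⟩ := (hQmem x hxτ.1.1 τ).1 hxτ.2
  have hvle : D.masterObjective v ≤ D.f v.x + τ := add_le_add le_rfl hvτ
  refine ⟨v, hv, fun v' hv' => ?_⟩
  rcases le_or_gt (∑ s, D.p s * v'.θ s) hi with h | h
  · exact hvle.trans (isMinOn_iff.1 hmin _ (hmemK v' hv' h))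
  · have h₁ : D.f v.x + τ ≤ D.masterObjective v₀ := isMinOn_iff.1 hmin _ h₀
    have h₂ := isMinOn_iff.1 hx₂ _ hv'.1
    have h₃ : D.masterObjective v' = D.f v'.x + ∑ s, D.p s * v'.θ s := rfl
    linarith

end MasterSolvable

end TwoStageCVaR

theorem mainTheorem2 {n₁ n₂ r d m t k : ℕ} (D : TwoStageCVaR n₁ n₂ r d m t k) (I : D.Input) :
    -- finitely many iterations: there is no infinite execution
    (¬ ∃ κ : ℕ → AlgConfig n₁ n₂ r d m, κ 0 = D.start I ∧ ∀ i, D.Step I (κ i) (κ (i + 1))) ∧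
    -- a report of infeasibility is a proof of infeasibility
    (D.Reachable I .infeasible → ∀ x y, ¬ D.IsFeasible x y) ∧
    -- a returned solution is optimal (within the tolerance; exactly for tolerance zero)
    (∀ x y, D.Reachable I (.optimal x y) →
      D.IsOptimalWithin I.ε x y ∧ (I.ε = 0 → D.IsOptimal x y)) ∧
    -- the algorithm goes on until it reports, as long as the relaxed master problem, if feasible,
    -- has an optimal solution
    (∀ σ, D.Reachable I (.running σ) →
      ((∃ v, D.MasterFeasible I σ v) → ∃ v, D.MasterOptimal I σ v) →
      ∃ κ, D.Step I (.running σ) κ) ∧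
    -- which is so for compact `X`, lower semicontinuous `f` and initial bounds on all `θ_s`
    (IsCompact D.X → LowerSemicontinuousOn D.f D.X → (∀ s, I.bounds s ≠ []) →
      ∀ σ, D.Reachable I (.running σ) →
        (∃ v, D.MasterFeasible I σ v) → ∃ v, D.MasterOptimal I σ v) := by
  refine ⟨TwoStageCVaR.not_exists_infinite_execution I,
    fun h => TwoStageCVaR.IsValidConfig.of_reachable h, fun x y h => ?_,
    fun σ _ hopt => TwoStageCVaR.exists_step hopt, fun hX hf hb σ hσ hne => ?_⟩
  · have hval : D.IsOptimalWithin I.ε x y := TwoStageCVaR.IsValidConfig.of_reachable h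
    refine ⟨hval, fun hε => ⟨hval.1, fun x' y' hxy' => ?_⟩⟩
    simpa [hε] using hval.2 x' y' hxy'
  · have hval : D.IsValidState σ := TwoStageCVaR.IsValidConfig.of_reachable hσ
    exact hval.exists_masterOptimal hX hf hb hne
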